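/- Let $\mathrm{Sol}_3$ be $\mathbb{R}^3$ with the Riemannian metric $\langle\,,\rangle=e^{2z}dx^2+e^{-2z}dy^2+dz^2$, Levi-Civita connection $\bar\nabla$ and orthonormal frame $E_1=e^{-z}\partial_x$, $E_2=e^{z}\partial_y$, $E_3=\partial_z$. Let $\phi:\Sigma^2\to\mathrm{Sol}_3$ be a smooth immersed surface (without boundary) with a smooth unit normal vector field $\xi$, and equip $\Sigma^2$ with the induced metric and connection $\nabla$. Let $A$ be the shape operator, $\bar\nabla_X\xi=-AX$, let $f=\frac12\operatorname{trace}A$ be the mean curvature function and $K$ the Gaussian curvature of $\Sigma^2$; denote by $X^\top$ and $X^\perp$ the tangent and normal parts of a vector field $X$ of $\mathrm{Sol}_3$ along $\Sigma^2$, and by $\operatorname{grad}$, $\operatorname{div}$, $\Delta=\operatorname{div}\operatorname{grad}$ the gradient, divergence and Laplacian of $\Sigma^2$. Then, at every point of $\Sigma^2$, $$ \begin{aligned} \tfrac12\Delta\big(|A|^2+2\langle\xi,E_3^\perp\rangle^2\big)={}&|\nabla A|^2-4|\operatorname{grad}f|^2-2\langle\xi,E_3^\perp\rangle\langle\operatorname{grad}f,E_3^\top\rangle\\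 &+2\operatorname{div}(A\operatorname{grad}f)-6\operatorname{div}\big(f\langle\xi,E_3^\perp\rangle E_3^\top\big)\\ &+2K(|A|^2-2f^2)+2\langle\xi,E_3^\perp\rangle^2(|A|^2+2f^2-3)\\ &-2\langle AE_3^\top,AE_3^\top\rangle-2f\langle AE_3^\top,E_3^\top\rangle\\ &+2-2\big(\langle\xi,E_2^\perp\rangle^2-\langle\xi,E_1^\perp\rangle^2\big)^2 . \end{aligned} $$ -/

import Mathlib

open scoped Manifold ContDiff

noncomputable section

/-! ### The homogeneous space `Sol₃` -/

/-- The underlying manifold `ℝ³` of `Sol₃`; the coordinates `x, y, z` of `q` are `q 0, q 1, q 2`.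
Tangent vectors at any point are written in the coordinate basis `∂/∂x, ∂/∂y, ∂/∂z`. -/
abbrev Sol : Type := EuclideanSpace ℝ (Fin 3)

namespace Sol

/-- The Riemannian metric `e^{2z} dx² + e^{-2z} dy² + dz²` at the point `q`. -/
def metric (q u v : Sol) : ℝ :=
  Real.exp (2 * q 2) * (u 0 * v 0) + Real.exp (-2 * q 2) * (u 1 * v 1) + u 2 * v 2

/-- `E₁ = e^{-z} ∂/∂x`. -/
def E₁ (q : Sol) : Sol := !₂[Real.exp (-q 2), 0, 0]

/-- `E₂ = e^{z} ∂/∂y`. -/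
def E₂ (q : Sol) : Sol := !₂[0, Real.exp (q 2), 0]

/-- `E₃ = ∂/∂z`. -/
def E₃ (_q : Sol) : Sol := !₂[0, 0, 1]

/-- The Christoffel symbols of `Sol₃`, as a bilinear map: `christoffel q u v` has the components
`∑ i j, Γᵏᵢⱼ(q) uⁱ vʲ`. The Levi-Civita connection is `∇̄_u V = D_u V + christoffel q u V`. The two
facts that characterise it (no torsion, compatibility with the metric) are `christoffel_comm` and
`fderiv_metric`. -/
def christoffel (q u v : Sol) : Sol :=
  !₂[u 0 * v 2 + u 2 * v 0,
    -(u 1 * v 2 + u 2 * v 1),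
    -(Real.exp (2 * q 2) * (u 0 * v 0)) + Real.exp (-2 * q 2) * (u 1 * v 1)]

theorem christoffel_comm (q u v : Sol) : christoffel q u v = christoffel q v u := by
  ext i
  fin_cases i <;> simp [christoffel] <;> ring

theorem fderiv_metric (q w u v : Sol) :
    fderiv ℝ (fun r : Sol => metric r u v) q w =
      metric q (christoffel q w u) v + metric q u (christoffel q w v) := by
  have h2 : HasFDerivAt (fun r : Sol => r 2) (EuclideanSpace.proj (2 : Fin 3) : Sol →L[ℝ] ℝ) q :=
    (EuclideanSpace.proj (2 : Fin 3) : Sol →L[ℝ] ℝ).hasFDerivAt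
  have h := ((((h2.const_mul 2).exp).mul_const (u 0 * v 0)).add
    (((h2.const_mul (-2)).exp).mul_const (u 1 * v 1))).add_const (u 2 * v 2)
  have h' : fderiv ℝ (fun r : Sol => metric r u v) q = _ := h.fderiv
  rw [h']
  simp [metric, christoffel]
  ring

end Sol

/-! ### Immersed surfaces in `Sol₃`

Throughout, `M` is a smooth surface and `φ : M → Sol` a map, which the theorem takes to be a smooth
immersion; `ξ : M → Sol` is a vector field along `φ`, which the theorem takes to be a smooth unit
normal. Vector fields on `M` are dependent functions `(p : M) → TangentSpace (𝓡 2) p`, and a vector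
field along `φ` is a function `M → Sol` whose value at `p` is a vector at `φ p`. -/

namespace SolSurface

variable {M : Type*} [TopologicalSpace M] [ChartedSpace (EuclideanSpace ℝ (Fin 2)) M]

/-- The differential `dφ_p X`. -/
def dmap (φ : M → Sol) (p : M) (X : TangentSpace (𝓡 2) p) : Sol :=
  mfderiv (𝓡 2) (𝓡 3) φ p X

/-- The differential `du_p X = X(u)` of a real function `u` on `M`. -/
def dfun (u : M → ℝ) (p : M) (X : TangentSpace (𝓡 2) p) : ℝ :=
  mfderiv (𝓡 2) 𝓘(ℝ, ℝ) u p X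

/-- The induced metric `⟨X, Y⟩` on `M`. -/
def inducedMetric (φ : M → Sol) (p : M) (X Y : TangentSpace (𝓡 2) p) : ℝ :=
  Sol.metric (φ p) (dmap φ p X) (dmap φ p Y)

/-- The standard basis of the tangent plane at `p`. -/
def basisVec (p : M) (i : Fin 2) : TangentSpace (𝓡 2) p :=
  (EuclideanSpace.single i (1 : ℝ) : EuclideanSpace ℝ (Fin 2))

/-- The matrix of the induced metric at `p` in that basis. -/
def gram (φ : M → Sol) (p : M) : Matrix (Fin 2) (Fin 2) ℝ :=
  Matrix.of fun i j => inducedMetric φ p (basisVec p i) (basisVec p j)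

/-- The metric trace `∑ i j, gⁱʲ B(bᵢ, bⱼ)` of a bilinear form on the tangent plane at `p`. It does
not depend on the basis; for an orthonormal one `{e₁, e₂}` it reads `B(e₁, e₁) + B(e₂, e₂)`. -/
def metricTrace (φ : M → Sol) (p : M)
    (B : TangentSpace (𝓡 2) p → TangentSpace (𝓡 2) p → ℝ) : ℝ :=
  ∑ i, ∑ j, (gram φ p)⁻¹ i j * B (basisVec p i) (basisVec p j)

/-- The tangent part `w^⊤` of a vector `w` at `φ p`: the orthogonal projection of `w` to the image
of `dφ_p`, read as a tangent vector of `M`. It is the unique `X` with `⟨dφ X, dφ Y⟩ = ⟨w, dφ Y⟩`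
for all `Y`. -/
def tangentPart (φ : M → Sol) (p : M) (w : Sol) : TangentSpace (𝓡 2) p :=
  ∑ i, ∑ j, ((gram φ p)⁻¹ i j * Sol.metric (φ p) w (dmap φ p (basisVec p j))) • basisVec p i

/-- The normal part `w^⊥ = w - w^⊤` of a vector `w` at `φ p`. -/
def normalPart (φ : M → Sol) (p : M) (w : Sol) : Sol :=
  w - dmap φ p (tangentPart φ p w)

/-- The covariant derivative `∇̄_X V` in `Sol₃` of a vector field `V` along `φ`. -/
def ambientCov (φ V : M → Sol) (p : M) (X : TangentSpace (𝓡 2) p) : Sol :=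
  dmap V p X + Sol.christoffel (φ p) (dmap φ p X) (V p)

/-- The induced connection: `∇_X Y` is the tangent part of `∇̄_X Y`. -/
def cov (φ : M → Sol) (Y : (p : M) → TangentSpace (𝓡 2) p) (p : M) (X : TangentSpace (𝓡 2) p) :
    TangentSpace (𝓡 2) p :=
  tangentPart φ p (ambientCov φ (fun q => dmap φ q (Y q)) p X)

/-- The gradient `grad u`: the vector field with `⟨grad u, X⟩ = X(u)`. -/
def grad (φ : M → Sol) (u : M → ℝ) (p : M) : TangentSpace (𝓡 2) p :=
  ∑ i, ∑ j, ((gram φ p)⁻¹ i j * dfun u p (basisVec p j)) • basisVec p i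

/-- The divergence `div W`, the trace of `X ↦ ∇_X W`. -/
def divergence (φ : M → Sol) (W : (p : M) → TangentSpace (𝓡 2) p) (p : M) : ℝ :=
  metricTrace φ p fun X Y => inducedMetric φ p (cov φ W p X) Y

/-- The Laplacian `Δu = div (grad u)`. -/
def laplacian (φ : M → Sol) (u : M → ℝ) (p : M) : ℝ :=
  divergence φ (grad φ u) p

/-- The curvature tensor of the surface on vector fields,
`R(X, Y)Z = ∇_X ∇_Y Z - ∇_Y ∇_X Z - ∇_{[X, Y]} Z`. -/
def curvature (φ : M → Sol) (X Y Z : (p : M) → TangentSpace (𝓡 2) p) (p : M) :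
    TangentSpace (𝓡 2) p :=
  cov φ (fun q => cov φ Z q (Y q)) p (X p) - cov φ (fun q => cov φ Z q (X q)) p (Y p)
    - cov φ Z p (VectorField.mlieBracket (𝓡 2) X Y p)

/-- A local vector field, smooth near `p`, with the value `v` at `p`. It is used to evaluate
tensorial expressions at `p`, which do not depend on the choice of the extension. -/
def ext [IsManifold (𝓡 2) ∞ M] {p : M} (v : TangentSpace (𝓡 2) p) (q : M) : TangentSpace (𝓡 2) q :=
  FiberBundle.extend (EuclideanSpace ℝ (Fin 2)) v q

/-- The Gaussian curvature
`K = ⟨R(X₁, X₂)X₂, X₁⟩ / (⟨X₁, X₁⟩⟨X₂, X₂⟩ - ⟨X₁, X₂⟩²)` of the induced metric. -/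
def gaussCurvature [IsManifold (𝓡 2) ∞ M] (φ : M → Sol) (p : M) : ℝ :=
  inducedMetric φ p
      (curvature φ (ext (basisVec p 0)) (ext (basisVec p 1)) (ext (basisVec p 1)) p)
      (basisVec p 0) / (gram φ p).det

/-- The shape operator `A`, given by `∇̄_X ξ = -AX`. -/
def shape (φ ξ : M → Sol) (p : M) (X : TangentSpace (𝓡 2) p) : TangentSpace (𝓡 2) p :=
  -tangentPart φ p (ambientCov φ ξ p X)

/-- The mean curvature function `f = (1/2) trace A`. -/
def meanCurvature (φ ξ : M → Sol) (p : M) : ℝ :=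
  (1 / 2) * metricTrace φ p fun X Y => inducedMetric φ p (shape φ ξ p X) Y

/-- `|A|²`, the sum of `|A eᵢ|²` over an orthonormal basis. -/
def shapeNormSq (φ ξ : M → Sol) (p : M) : ℝ :=
  metricTrace φ p fun X Y => inducedMetric φ p (shape φ ξ p X) (shape φ ξ p Y)

/-- The covariant derivative of the shape operator, `(∇_X A)Y = ∇_X (AY) - A(∇_X Y)`. -/
def covShape [IsManifold (𝓡 2) ∞ M] (φ ξ : M → Sol) (p : M)
    (X Y : TangentSpace (𝓡 2) p) : TangentSpace (𝓡 2) p :=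
  cov φ (fun q => shape φ ξ q (ext Y q)) p X - shape φ ξ p (cov φ (ext Y) p X)

/-- `|∇A|²`, the sum of `|(∇_{eᵢ} A) eⱼ|²` over an orthonormal basis. -/
def covShapeNormSq [IsManifold (𝓡 2) ∞ M] (φ ξ : M → Sol) (p : M) : ℝ :=
  metricTrace φ p fun X X' => metricTrace φ p fun Y Y' =>
    inducedMetric φ p (covShape φ ξ p X Y) (covShape φ ξ p X' Y')

/-- The function `⟨ξ, E^⊥⟩` on the surface, for a vector field `E` on `Sol₃`. -/
def angle (φ ξ : M → Sol) (E : Sol → Sol) (p : M) : ℝ :=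
  Sol.metric (φ p) (ξ p) (normalPart φ p (E (φ p)))

/-- The tangent part `E^⊤` along the surface of a vector field `E` on `Sol₃`. -/
def tangentField (φ : M → Sol) (E : Sol → Sol) (p : M) : TangentSpace (𝓡 2) p :=
  tangentPart φ p (E (φ p))

end SolSurface

end

/-! The formula is a Simons computation. In a local orthonormal tangent frame with connection form ω
and second fundamental form h, the Codazzi equation lets the second derivatives of h in Δ|A|² be
reordered until they are derivatives of the trace; the commutators produce the Gaussian curvature.
The curvature of Sol₃ enters only through the Gauss equation K = det A + 2ν² - 1 and the Codazzi
defect, a multiple of ν E₃^⊤, where ν = ⟨ξ, E₃⟩.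

The terms special to Sol₃ come from ⟨∇̄_X E₃, Y⟩ = P(X, Y), with P the symmetric form of ⟨·, E₁⟩² -
⟨·, E₂⟩². Hence grad ν is -A E₃^⊤ plus the tangent vector dual to P(ξ, ·). Since P is trace-free,
has E₃ in its kernel and satisfies |P(ξ, ·)|² = 1 - ν², the term 2|grad ν|² in ½Δ(2ν²) contributes
2(1 - ν² - P(ξ, ξ)²), the origin of the closing square in the formula.

All of this is polynomial algebra in a commutative ring with two derivations. `simons_core` is the
identity under the structure equations as hypotheses. `SolFrame` keeps only orthonormality, a
commutator rule and vanishing torsion, and from these `SolFrame.gauss`, `SolFrame.codazzi₁` and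
`SolFrame.codazzi₂` follow by commuting the derivations on the components of the frame;
`SolFrame.simons` is the result.

The ring for an actual surface consists of the smooth functions on a chart domain. Coordinate fields
give commuting derivations, and Gram–Schmidt (`SolChart.frame`) gives the orthonormal frame.
`tangentPart_ambientCov_e₁` and `tangentPart_ambientCov_e₂` translate geometric covariant
derivatives into the ring, and evaluation at the point concludes. -/

noncomputable section

/-! ### Simons' identity as differential algebra -/

/-- Simons' formula in an orthonormal frame, with the structure equations of the surface as
hypotheses: `c₁, c₂, ν` are the components of `E₃`, and `pᵢⱼ, pᵢ, p₀` those of the quadratic form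
`⟨·, E₁⟩² - ⟨·, E₂⟩²`. -/
theorem simons_core {R : Type*} [CommRing R] [Algebra ℝ R] (D₁ D₂ : Derivation ℝ R R)
    (c₁ c₂ ν p₁₁ p₁₂ p₂₂ p₁ p₂ p₀ h₁₁ h₁₂ h₂₂ ω₁ ω₂ K : R)
    (comm : ∀ u, D₁ (D₂ u) = D₂ (D₁ u) - ω₁ * D₁ u - ω₂ * D₂ u)
    (codazzi₁ : D₂ h₁₁ = D₁ h₁₂ + ω₁ * (h₁₁ - h₂₂) + 2 * ω₂ * h₁₂ - 2 * ν * c₂)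
    (codazzi₂ : D₁ h₂₂ = D₂ h₁₂ + ω₂ * (h₁₁ - h₂₂) - 2 * ω₁ * h₁₂ - 2 * ν * c₁)
    (gauss : D₁ ω₂ = D₂ ω₁ - ω₁ ^ 2 - ω₂ ^ 2 - K)
    (hK : K = h₁₁ * h₂₂ - h₁₂ ^ 2 + 2 * ν ^ 2 - 1)
    (c₁₁ : D₁ c₁ = ω₁ * c₂ + h₁₁ * ν + p₁₁) (c₂₁ : D₂ c₁ = ω₂ * c₂ + h₁₂ * ν + p₁₂)
    (c₁₂ : D₁ c₂ = -(ω₁ * c₁) + h₁₂ * ν + p₁₂) (c₂₂ : D₂ c₂ = -(ω₂ * c₁) + h₂₂ * ν + p₂₂)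
    (ν₁ : D₁ ν = -(h₁₁ * c₁) - h₁₂ * c₂ + p₁) (ν₂ : D₂ ν = -(h₁₂ * c₁) - h₂₂ * c₂ + p₂)
    (p₁₁' : D₁ p₁ = ω₁ * p₂ + h₁₁ * p₀ - h₁₁ * p₁₁ - h₁₂ * p₁₂ + 2 * c₁ ^ 2 * ν - ν)
    (p₂₂' : D₂ p₂ = -(ω₂ * p₁) + h₂₂ * p₀ - h₁₂ * p₁₂ - h₂₂ * p₂₂ + 2 * c₂ ^ 2 * ν - ν)
    (htr : p₁₁ + p₂₂ + p₀ = 0) (hp₀ : p₁ * c₁ + p₂ * c₂ + p₀ * ν = 0)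
    (hpp : p₁ ^ 2 + p₂ ^ 2 + p₀ ^ 2 = 1 - ν ^ 2)
    (τ A₂ u v₁ v₂ w₁ w₂ a₁₁₁ a₁₁₂ a₁₂₁ a₁₂₂ a₂₂₁ a₂₂₂ : R)
    (hτ : τ = h₁₁ + h₂₂)
    (hA₂ : A₂ = h₁₁ ^ 2 + 2 * h₁₂ ^ 2 + h₂₂ ^ 2)
    (hu : u = A₂ + 2 * ν ^ 2)
    (hv₁ : v₁ = h₁₁ * D₁ τ + h₁₂ * D₂ τ) (hv₂ : v₂ = h₁₂ * D₁ τ + h₂₂ * D₂ τ)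
    (hw₁ : w₁ = τ * ν * c₁) (hw₂ : w₂ = τ * ν * c₂)
    (ha₁₁₁ : a₁₁₁ = D₁ h₁₁ - 2 * ω₁ * h₁₂) (ha₁₁₂ : a₁₁₂ = D₂ h₁₁ - 2 * ω₂ * h₁₂)
    (ha₁₂₁ : a₁₂₁ = D₁ h₁₂ + ω₁ * (h₁₁ - h₂₂)) (ha₁₂₂ : a₁₂₂ = D₂ h₁₂ + ω₂ * (h₁₁ - h₂₂))
    (ha₂₂₁ : a₂₂₁ = D₁ h₂₂ + 2 * ω₁ * h₁₂) (ha₂₂₂ : a₂₂₂ = D₂ h₂₂ + 2 * ω₂ * h₁₂) :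
    D₁ (D₁ u) + D₂ (D₂ u) - ω₁ * D₂ u + ω₂ * D₁ u = 2 * (
      (a₁₁₁ ^ 2 + 2 * a₁₂₁ ^ 2 + a₂₂₁ ^ 2 + a₁₁₂ ^ 2 + 2 * a₁₂₂ ^ 2 + a₂₂₂ ^ 2)
      - (D₁ τ ^ 2 + D₂ τ ^ 2) - ν * (D₁ τ * c₁ + D₂ τ * c₂)
      + (D₁ v₁ + D₂ v₂ - ω₁ * v₂ + ω₂ * v₁)
      - 3 * (D₁ w₁ + D₂ w₂ - ω₁ * w₂ + ω₂ * w₁)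
      + K * (2 * A₂ - τ ^ 2) + ν ^ 2 * (2 * A₂ + τ ^ 2 - 6)
      - 2 * ((h₁₁ * c₁ + h₁₂ * c₂) ^ 2 + (h₁₂ * c₁ + h₂₂ * c₂) ^ 2)
      - τ * (h₁₁ * c₁ ^ 2 + 2 * h₁₂ * c₁ * c₂ + h₂₂ * c₂ ^ 2)
      + 2 - 2 * p₀ ^ 2) := by
  have D2 (D : Derivation ℝ R R) : D 2 = 0 := D.map_natCast 2
  subst hτ hA₂ hu hv₁ hv₂ hw₁ hw₂ ha₁₁₁ ha₁₁₂ ha₁₂₁ ha₁₂₂ ha₂₂₁ ha₂₂₂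
  -- The commutator of the derivations on h₁₁, with Codazzi inserted. It is isolated because in the
  -- simplification of the goal `codazzi₁` replaces `D₂ h₁₁` before `comm` could act on `D₁ (D₂
  -- h₁₁)`, so this relation would be lost.
  have key : D₂ (D₁ h₁₁) - ω₁ * D₁ h₁₁ - ω₂ * D₂ h₁₁
      = D₁ (D₁ h₁₂ + ω₁ * (h₁₁ - h₂₂) + 2 * ω₂ * h₁₂ - 2 * ν * c₂) := by
    rw [← codazzi₁, comm]
  simp only [map_add, map_sub, Derivation.leibniz, smul_eq_mul, D2, codazzi₁, codazzi₂,
    c₁₂, ν₁, gauss] at key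
  simp only [map_add, map_sub, map_neg, map_zero, Derivation.leibniz, Derivation.leibniz_pow,
    smul_eq_mul, nsmul_eq_mul, Nat.cast_ofNat, D2, Nat.reduceSub, pow_one, codazzi₁, codazzi₂,
    comm, c₁₁, c₂₁, c₁₂, c₂₂, ν₁, ν₂, p₁₁', p₂₂', gauss]
  subst hK
  -- `hp₀` and `htr` remove the terms where P meets the trace τ, and `hpp` turns the squares p₁² +
  -- p₂² coming from |grad ν|² into 1 - ν² - p₀².
  linear_combination -2 * h₁₂ * key + 2 * (h₁₁ + h₂₂) * hp₀ + 2 * ν * (h₁₁ + h₂₂) * htr + 4 * hpp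

/-! ### Orthonormal frames along a surface and their structure equations -/

/-- Christoffel symbols in the orthonormal frame. -/
def solGamma {R : Type*} [CommRing R] (u v : Fin 3 → R) : Fin 3 → R :=
  ![u 0 * v 2, -(u 1 * v 2), -(u 0 * v 0) + u 1 * v 1]

/-- The dot product of component vectors. -/
def dot {R : Type*} [CommRing R] (u v : Fin 3 → R) : R := u 0 * v 0 + u 1 * v 1 + u 2 * v 2

theorem dot_comm {R : Type*} [CommRing R] (u v : Fin 3 → R) : dot u v = dot v u := by
  simp only [dot]; ring

/-- Two derivations with the components (in the frame `E₁, E₂, E₃` of `Sol₃`) of an orthonormal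
frame `a, b, n` along a surface, where `a, b` are tangent to it and correspond to the derivations. -/
structure SolFrame (R : Type*) [CommRing R] [Algebra ℝ R] where
  D₁ : Derivation ℝ R R
  D₂ : Derivation ℝ R R
  a : Fin 3 → R
  b : Fin 3 → R
  n : Fin 3 → R
  aa : dot a a = 1
  bb : dot b b = 1
  nn : dot n n = 1
  ab : dot a b = 0
  an : dot a n = 0
  bn : dot b n = 0
  k₁ : R
  k₂ : R
  comm : ∀ u, D₁ (D₂ u) - D₂ (D₁ u) = k₁ * D₁ u + k₂ * D₂ u
  torsion : ∀ m, D₁ (b m) + solGamma a b m - (D₂ (a m) + solGamma b a m) = k₁ * a m + k₂ * b m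

/-- The components of the covariant derivative of `v` in the direction `e`, where `D` is the
derivation that corresponds to `e`. -/
def solNabla {R : Type*} [CommRing R] [Algebra ℝ R] (D : Derivation ℝ R R) (e v : Fin 3 → R) :
    Fin 3 → R := fun m => D (v m) + solGamma e v m

section
variable {R : Type*} [CommRing R] [Algebra ℝ R]
theorem derivation_dot (D : Derivation ℝ R R) (e u v : Fin 3 → R) :
    D (dot u v) = dot (solNabla D e u) v + dot u (solNabla D e v) := by
  simp [dot, solNabla, solGamma]; ring

theorem dot_nabla_self (D : Derivation ℝ R R) (e : Fin 3 → R) {u : Fin 3 → R} (h : dot u u = 1) :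
    dot (solNabla D e u) u = 0 := by
  have := derivation_dot D e u u
  rw [h, D.map_one_eq_zero, dot_comm u, ← two_smul ℝ] at this
  -- The ring may have zero divisors, but 2 can be cancelled because it is a real algebra.
  exact (smul_eq_zero_iff_right (two_ne_zero (α := ℝ))).1 this.symm

theorem dot_nabla_swap (D : Derivation ℝ R R) (e : Fin 3 → R) {u v : Fin 3 → R}
    (h : dot u v = 0) : dot (solNabla D e v) u = - dot (solNabla D e u) v := by
  have := derivation_dot D e u v
  rw [h, map_zero, dot_comm u] at this
  linear_combination -this

namespace SolFrame
variable (S : SolFrame R)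

/-- The connection form of the frame, on its first vector. -/
def ω₁ : R := dot (solNabla S.D₁ S.a S.a) S.b

/-- The connection form of the frame, on its second vector. -/
def ω₂ : R := dot (solNabla S.D₂ S.b S.a) S.b

/-- The second fundamental form on the first vector. -/
def h₁₁ : R := dot (solNabla S.D₁ S.a S.a) S.n

/-- The second fundamental form on the mixed pair. -/
def h₁₂ : R := dot (solNabla S.D₁ S.a S.b) S.n

/-- The second fundamental form on the second vector. -/
def h₂₂ : R := dot (solNabla S.D₂ S.b S.b) S.n

/-- A square matrix with orthonormal rows also has orthonormal columns. This is what makes every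
vector expand in a, b, n. -/
theorem columns (i j : Fin 3) :
    S.a i * S.a j + S.b i * S.b j + S.n i * S.n j = if i = j then 1 else 0 := by
  have h : Matrix.of ![S.a, S.b, S.n] * (Matrix.of ![S.a, S.b, S.n]).transpose = 1 := by
    have haa := S.aa; have hbb := S.bb; have hnn := S.nn
    have hab := S.ab; have han := S.an; have hbn := S.bn
    simp only [dot] at *
    ext i j
    fin_cases i <;> fin_cases j <;> simp [Matrix.mul_apply, Fin.sum_univ_three] <;>
      first
        | linear_combination haa | linear_combination hbb | linear_combination hnn
        | linear_combination hab | linear_combination han | linear_combination hbn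
  rw [mul_eq_one_comm] at h
  have := congrFun (congrFun h i) j
  simpa [Matrix.mul_apply, Fin.sum_univ_three, Matrix.one_apply] using this

theorem expand (v : Fin 3 → R) (m : Fin 3) :
    v m = dot v S.a * S.a m + dot v S.b * S.b m + dot v S.n * S.n m := by
  have h0 := S.columns 0 m
  have h1 := S.columns 1 m
  have h2 := S.columns 2 m
  simp only [dot]
  fin_cases m <;> simp at * <;>
  linear_combination -(v 0) * h0 - v 1 * h1 - v 2 * h2

theorem torsion_dot (v : Fin 3 → R) :
    dot (solNabla S.D₁ S.a S.b) v - dot (solNabla S.D₂ S.b S.a) v =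
      S.k₁ * dot S.a v + S.k₂ * dot S.b v := by
  have h0 := S.torsion 0
  have h1 := S.torsion 1
  have h2 := S.torsion 2
  simp only [dot, solNabla]
  linear_combination v 0 * h0 + v 1 * h1 + v 2 * h2

/-- Symmetry of the second fundamental form: the normal component of the torsion equation, the
bracket being tangent. -/
theorem h₂₁ : dot (solNabla S.D₂ S.b S.a) S.n = S.h₁₂ := by
  have := S.torsion_dot S.n
  rw [S.an, S.bn] at this
  simp only [h₁₂]
  linear_combination -this

/-- The tangential components of the torsion equation determine the bracket of the frame from the
connection form. -/
theorem k₁_eq : S.k₁ = -S.ω₁ := by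
  have := S.torsion_dot S.a
  rw [dot_comm S.b, S.ab, S.aa, dot_nabla_self S.D₂ S.b S.aa, dot_nabla_swap _ _ S.ab] at this
  simp only [ω₁]
  linear_combination -this

theorem k₂_eq : S.k₂ = -S.ω₂ := by
  have := S.torsion_dot S.b
  rw [S.ab, S.bb, dot_nabla_self S.D₁ S.a S.bb] at this
  simp only [ω₂]
  linear_combination -this

theorem derivation_comm (u : R) :
    S.D₁ (S.D₂ u) = S.D₂ (S.D₁ u) - S.ω₁ * S.D₁ u - S.ω₂ * S.D₂ u := by
  have := S.comm u
  rw [S.k₁_eq, S.k₂_eq] at this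
  linear_combination this

theorem nabla₁_a (m : Fin 3) : solNabla S.D₁ S.a S.a m = S.ω₁ * S.b m + S.h₁₁ * S.n m := by
  rw [S.expand (solNabla S.D₁ S.a S.a) m, dot_nabla_self _ _ S.aa, ω₁, h₁₁]; ring

theorem nabla₁_b (m : Fin 3) : solNabla S.D₁ S.a S.b m = -(S.ω₁ * S.a m) + S.h₁₂ * S.n m := by
  rw [S.expand (solNabla S.D₁ S.a S.b) m, dot_nabla_self _ _ S.bb, dot_nabla_swap _ _ S.ab, ω₁,
    h₁₂]; ring

theorem nabla₁_n (m : Fin 3) :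
    solNabla S.D₁ S.a S.n m = -(S.h₁₁ * S.a m) - S.h₁₂ * S.b m := by
  rw [S.expand (solNabla S.D₁ S.a S.n) m, dot_nabla_self _ _ S.nn, dot_nabla_swap _ _ S.an,
    dot_nabla_swap _ _ S.bn, h₁₁, h₁₂]; ring

theorem nabla₂_a (m : Fin 3) : solNabla S.D₂ S.b S.a m = S.ω₂ * S.b m + S.h₁₂ * S.n m := by
  rw [S.expand (solNabla S.D₂ S.b S.a) m, dot_nabla_self _ _ S.aa, ω₂, S.h₂₁]; ring

theorem nabla₂_b (m : Fin 3) : solNabla S.D₂ S.b S.b m = -(S.ω₂ * S.a m) + S.h₂₂ * S.n m := by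
  rw [S.expand (solNabla S.D₂ S.b S.b) m, dot_nabla_self _ _ S.bb, dot_nabla_swap _ _ S.ab, ω₂,
    h₂₂]; ring

theorem nabla₂_n (m : Fin 3) :
    solNabla S.D₂ S.b S.n m = -(S.h₁₂ * S.a m) - S.h₂₂ * S.b m := by
  rw [S.expand (solNabla S.D₂ S.b S.n) m, dot_nabla_self _ _ S.nn, dot_nabla_swap _ _ S.an,
    dot_nabla_swap _ _ S.bn, h₂₂, S.h₂₁]; ring

/-! ### Gauss and Codazzi equations -/

/-- The curvature of `Sol₃` on the tangent plane of the surface. -/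
def ambientCurvature (v : Fin 3 → R) (m : Fin 3) : R :=
  solGamma S.a (solGamma S.b v) m - solGamma S.b (solGamma S.a v) m
    - solGamma (solGamma S.a S.b - solGamma S.b S.a) v m

/-- Apply the commutator rule to each component of a and substitute the structure equations. The
Christoffel symbols are constant in the frame E₁, E₂, E₃, so they leave only the algebraic curvature
term. The coefficient of b is the Gauss expression, that of n the Codazzi expression. -/
theorem curvature_a (m : Fin 3) :
    (S.D₁ S.ω₂ - S.D₂ S.ω₁ + S.ω₁ ^ 2 + S.ω₂ ^ 2 + S.h₁₁ * S.h₂₂ - S.h₁₂ ^ 2) * S.b m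
      + (S.D₁ S.h₁₂ - S.D₂ S.h₁₁ + S.ω₁ * (S.h₁₁ - S.h₂₂) + 2 * S.ω₂ * S.h₁₂) * S.n m
      = S.ambientCurvature S.a m := by
  have h1a := S.nabla₁_a
  have h1b := S.nabla₁_b
  have h1n := S.nabla₁_n
  have h2a := S.nabla₂_a
  have h2b := S.nabla₂_b
  have h2n := S.nabla₂_n
  simp only [solNabla, ← eq_sub_iff_add_eq] at h1a h1b h1n h2a h2b h2n
  have := S.derivation_comm (S.a m)
  rw [h1a, h2a] at this
  simp only [ambientCurvature]
  fin_cases m <;> simp [solGamma] at this ⊢ <;>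
    simp only [h1a, h1b, h1n, h2a, h2b, h2n, solGamma] at this <;> simp at this <;>
    linear_combination this

theorem curvature_b (m : Fin 3) :
    -(S.D₁ S.ω₂ - S.D₂ S.ω₁ + S.ω₁ ^ 2 + S.ω₂ ^ 2 + S.h₁₁ * S.h₂₂ - S.h₁₂ ^ 2) * S.a m
      + (S.D₁ S.h₂₂ - S.D₂ S.h₁₂ - S.ω₂ * (S.h₁₁ - S.h₂₂) + 2 * S.ω₁ * S.h₁₂) * S.n m
      = S.ambientCurvature S.b m := by
  have h1a := S.nabla₁_a
  have h1b := S.nabla₁_b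
  have h1n := S.nabla₁_n
  have h2a := S.nabla₂_a
  have h2b := S.nabla₂_b
  have h2n := S.nabla₂_n
  simp only [solNabla, ← eq_sub_iff_add_eq] at h1a h1b h1n h2a h2b h2n
  have := S.derivation_comm (S.b m)
  rw [h1b, h2b] at this
  simp only [ambientCurvature]
  fin_cases m <;> simp [solGamma] at this ⊢ <;>
    simp only [h1a, h1b, h1n, h2a, h2b, h2n, solGamma] at this <;> simp at this <;>
    linear_combination this

/-- Minus the sectional curvature 2ν² - 1 of the tangent plane: a horizontal plane has curvature 1,
a plane containing E₃ has curvature -1. -/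
theorem ambientCurvature_a_b : dot (S.ambientCurvature S.a) S.b = 1 - 2 * S.n 2 ^ 2 := by
  have haa := S.aa; have hbb := S.bb; have hab := S.ab
  have hc := S.columns 2 2
  simp only [dot, if_true] at haa hbb hab hc
  simp [dot, ambientCurvature, solGamma]
  linear_combination (-(S.b 0 ^ 2 + S.b 1 ^ 2) + S.b 2 ^ 2) * haa + (2 * S.a 2 ^ 2 - 1) * hbb
    + (S.a 0 * S.b 0 + S.a 1 * S.b 1 - 3 * S.a 2 * S.b 2) * hab + 2 * hc

theorem ambientCurvature_a_n : dot (S.ambientCurvature S.a) S.n = 2 * S.n 2 * S.b 2 := by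
  have haa := S.aa; have hbn := S.bn; have hab := S.ab; have han := S.an
  simp only [dot] at haa hbn hab han
  simp [dot, ambientCurvature, solGamma]
  linear_combination (-(S.b 0 * S.n 0 + S.b 1 * S.n 1) + S.b 2 * S.n 2) * haa
    + (2 * S.a 2 ^ 2 - 1) * hbn - 2 * S.a 2 * S.n 2 * hab
    + (S.a 0 * S.b 0 + S.a 1 * S.b 1 - S.a 2 * S.b 2) * han

theorem ambientCurvature_b_n : dot (S.ambientCurvature S.b) S.n = -(2 * S.n 2 * S.a 2) := by
  have hbb := S.bb; have hbn := S.bn; have hab := S.ab; have han := S.an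
  simp only [dot] at hbb hbn hab han
  simp [dot, ambientCurvature, solGamma]
  linear_combination -(-(S.a 0 * S.n 0 + S.a 1 * S.n 1) + S.a 2 * S.n 2) * hbb
    - (2 * S.b 2 ^ 2 - 1) * han + 2 * S.b 2 * S.n 2 * hab
    - (S.a 0 * S.b 0 + S.a 1 * S.b 1 - S.a 2 * S.b 2) * hbn

/-- The Gaussian curvature, as given by the Gauss equation. -/
def K : R := S.h₁₁ * S.h₂₂ - S.h₁₂ ^ 2 + 2 * S.n 2 ^ 2 - 1

theorem gauss : S.D₁ S.ω₂ = S.D₂ S.ω₁ - S.ω₁ ^ 2 - S.ω₂ ^ 2 - S.K := by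
  have h0 := S.curvature_a 0
  have h1 := S.curvature_a 1
  have h2 := S.curvature_a 2
  have h := S.ambientCurvature_a_b
  have hbb := S.bb; have hbn := S.bn
  simp only [dot, K] at *
  linear_combination S.b 0 * h0 + S.b 1 * h1 + S.b 2 * h2 + h
    - (S.D₁ S.ω₂ - S.D₂ S.ω₁ + S.ω₁ ^ 2 + S.ω₂ ^ 2 + S.h₁₁ * S.h₂₂ - S.h₁₂ ^ 2) * hbb
    - (S.D₁ S.h₁₂ - S.D₂ S.h₁₁ + S.ω₁ * (S.h₁₁ - S.h₂₂) + 2 * S.ω₂ * S.h₁₂) * hbn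

theorem codazzi₁ : S.D₂ S.h₁₁ =
    S.D₁ S.h₁₂ + S.ω₁ * (S.h₁₁ - S.h₂₂) + 2 * S.ω₂ * S.h₁₂ - 2 * S.n 2 * S.b 2 := by
  have h0 := S.curvature_a 0
  have h1 := S.curvature_a 1
  have h2 := S.curvature_a 2
  have h := S.ambientCurvature_a_n
  have hnn := S.nn; have hbn := S.bn
  simp only [dot] at *
  linear_combination -(S.n 0 * h0 + S.n 1 * h1 + S.n 2 * h2 + h
    - (S.D₁ S.ω₂ - S.D₂ S.ω₁ + S.ω₁ ^ 2 + S.ω₂ ^ 2 + S.h₁₁ * S.h₂₂ - S.h₁₂ ^ 2) * hbn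
    - (S.D₁ S.h₁₂ - S.D₂ S.h₁₁ + S.ω₁ * (S.h₁₁ - S.h₂₂) + 2 * S.ω₂ * S.h₁₂) * hnn)

theorem codazzi₂ : S.D₁ S.h₂₂ =
    S.D₂ S.h₁₂ + S.ω₂ * (S.h₁₁ - S.h₂₂) - 2 * S.ω₁ * S.h₁₂ - 2 * S.n 2 * S.a 2 := by
  have h0 := S.curvature_b 0
  have h1 := S.curvature_b 1
  have h2 := S.curvature_b 2
  have h := S.ambientCurvature_b_n
  have hnn := S.nn; have han := S.an
  simp only [dot] at *
  linear_combination (S.n 0 * h0 + S.n 1 * h1 + S.n 2 * h2 + h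
    + (S.D₁ S.ω₂ - S.D₂ S.ω₁ + S.ω₁ ^ 2 + S.ω₂ ^ 2 + S.h₁₁ * S.h₂₂ - S.h₁₂ ^ 2) * han
    - (S.D₁ S.h₂₂ - S.D₂ S.h₁₂ - S.ω₂ * (S.h₁₁ - S.h₂₂) + 2 * S.ω₁ * S.h₁₂) * hnn)

/-! ### Simons' formula for a frame -/

/-- The bilinear form `⟨·, E₁⟩⟨·, E₁⟩ - ⟨·, E₂⟩⟨·, E₂⟩`. -/
def P (u v : Fin 3 → R) : R := u 0 * v 0 - u 1 * v 1

/-- Simons' formula for an orthonormal frame along a surface in `Sol₃`. -/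
theorem simons (τ A₂ u v₁ v₂ w₁ w₂ a₁₁₁ a₁₁₂ a₁₂₁ a₁₂₂ a₂₂₁ a₂₂₂ : R)
    (hτ : τ = S.h₁₁ + S.h₂₂)
    (hA₂ : A₂ = S.h₁₁ ^ 2 + 2 * S.h₁₂ ^ 2 + S.h₂₂ ^ 2)
    (hu : u = A₂ + 2 * S.n 2 ^ 2)
    (hv₁ : v₁ = S.h₁₁ * S.D₁ τ + S.h₁₂ * S.D₂ τ) (hv₂ : v₂ = S.h₁₂ * S.D₁ τ + S.h₂₂ * S.D₂ τ)
    (hw₁ : w₁ = τ * S.n 2 * S.a 2) (hw₂ : w₂ = τ * S.n 2 * S.b 2)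
    (ha₁₁₁ : a₁₁₁ = S.D₁ S.h₁₁ - 2 * S.ω₁ * S.h₁₂)
    (ha₁₁₂ : a₁₁₂ = S.D₂ S.h₁₁ - 2 * S.ω₂ * S.h₁₂)
    (ha₁₂₁ : a₁₂₁ = S.D₁ S.h₁₂ + S.ω₁ * (S.h₁₁ - S.h₂₂))
    (ha₁₂₂ : a₁₂₂ = S.D₂ S.h₁₂ + S.ω₂ * (S.h₁₁ - S.h₂₂))
    (ha₂₂₁ : a₂₂₁ = S.D₁ S.h₂₂ + 2 * S.ω₁ * S.h₁₂)
    (ha₂₂₂ : a₂₂₂ = S.D₂ S.h₂₂ + 2 * S.ω₂ * S.h₁₂) :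
    S.D₁ (S.D₁ u) + S.D₂ (S.D₂ u) - S.ω₁ * S.D₂ u + S.ω₂ * S.D₁ u = 2 * (
      (a₁₁₁ ^ 2 + 2 * a₁₂₁ ^ 2 + a₂₂₁ ^ 2 + a₁₁₂ ^ 2 + 2 * a₁₂₂ ^ 2 + a₂₂₂ ^ 2)
      - (S.D₁ τ ^ 2 + S.D₂ τ ^ 2) - S.n 2 * (S.D₁ τ * S.a 2 + S.D₂ τ * S.b 2)
      + (S.D₁ v₁ + S.D₂ v₂ - S.ω₁ * v₂ + S.ω₂ * v₁)
      - 3 * (S.D₁ w₁ + S.D₂ w₂ - S.ω₁ * w₂ + S.ω₂ * w₁)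
      + S.K * (2 * A₂ - τ ^ 2) + S.n 2 ^ 2 * (2 * A₂ + τ ^ 2 - 6)
      - 2 * ((S.h₁₁ * S.a 2 + S.h₁₂ * S.b 2) ^ 2 + (S.h₁₂ * S.a 2 + S.h₂₂ * S.b 2) ^ 2)
      - τ * (S.h₁₁ * S.a 2 ^ 2 + 2 * S.h₁₂ * S.a 2 * S.b 2 + S.h₂₂ * S.b 2 ^ 2)
      + 2 - 2 * P S.n S.n ^ 2) := by
  have h1a := S.nabla₁_a
  have h1b := S.nabla₁_b
  have h1n := S.nabla₁_n
  have h2a := S.nabla₂_a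
  have h2b := S.nabla₂_b
  have h2n := S.nabla₂_n
  simp only [solNabla, ← eq_sub_iff_add_eq] at h1a h1b h1n h2a h2b h2n
  have haa := S.aa; have hbb := S.bb; have hnn := S.nn
  have hab := S.ab; have han := S.an; have hbn := S.bn
  have c01 := S.columns 0 1
  have c02 := S.columns 0 2
  have c12 := S.columns 1 2
  have c00 := S.columns 0 0
  have c11 := S.columns 1 1
  have c22 := S.columns 2 2
  simp [dot] at haa hbb hnn hab han hbn c01 c02 c12 c00 c11 c22
  refine simons_core S.D₁ S.D₂ (S.a 2) (S.b 2) (S.n 2) (P S.a S.a) (P S.a S.b) (P S.b S.b)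
    (P S.a S.n) (P S.b S.n) (P S.n S.n) S.h₁₁ S.h₁₂ S.h₂₂ S.ω₁ S.ω₂ S.K
    S.derivation_comm S.codazzi₁ S.codazzi₂ S.gauss rfl ?_ ?_ ?_ ?_ ?_ ?_ ?_ ?_ ?_ ?_ ?_ τ A₂ u
    v₁ v₂ w₁ w₂ _ _ _ _ _ _ hτ hA₂ hu hv₁ hv₂ hw₁ hw₂ ha₁₁₁ ha₁₁₂ ha₁₂₁ ha₁₂₂ ha₂₂₁ ha₂₂₂
  -- The derivatives of the components of E₃: the third component of each structure equation, where
  -- `solGamma` contributes ⟨∇̄_X E₃, Y⟩ = P(X, Y).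
  · rw [h1a]; simp [solGamma, P]; ring
  · rw [h2a]; simp [solGamma, P]; ring
  · rw [h1b]; simp [solGamma, P]; ring
  · rw [h2b]; simp [solGamma, P]; ring
  · rw [h1n]; simp [solGamma, P]; ring
  · rw [h2n]; simp [solGamma, P]; ring
  · simp only [P, map_sub, Derivation.leibniz, smul_eq_mul, h1a, h1n, solGamma]
    simp
    linear_combination -S.n 2 * haa - S.a 2 * han
  · simp only [P, map_sub, Derivation.leibniz, smul_eq_mul, h2b, h2n, solGamma]
    simp
    linear_combination -S.n 2 * hbb - S.b 2 * hbn
  -- The three remaining goals say that P is trace-free, that E₃ lies in its kernel, and that |P(n,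
  -- ·)|² = 1 - ν². They follow from orthonormality of the columns of the frame matrix and |n| = 1.
  · simp only [P]
    linear_combination c00 - c11
  · simp only [P]
    linear_combination S.n 0 * c02 - S.n 1 * c12
  · simp only [P]
    linear_combination S.n 0 ^ 2 * c00 + S.n 1 ^ 2 * c11 - 2 * S.n 0 * S.n 1 * c01 + hnn
end SolFrame
end

/-! ### Pointwise linear algebra of the metric and the tangent plane -/

namespace Sol

/-- The components of a tangent vector in the orthonormal frame `E₁, E₂, E₃`. -/
def comp (q w : Sol) : Fin 3 → ℝ := ![Real.exp (q 2) * w 0, Real.exp (-q 2) * w 1, w 2]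

theorem metric_eq_dot (q u v : Sol) : metric q u v = dot (comp q u) (comp q v) := by
  have h1 : Real.exp (2 * q 2) = Real.exp (q 2) * Real.exp (q 2) := by
    rw [← Real.exp_add]; ring_nf
  have h2 : Real.exp (-2 * q 2) = Real.exp (-q 2) * Real.exp (-q 2) := by
    rw [← Real.exp_add]; ring_nf
  simp only [metric, dot, comp, h1, h2]
  simp
  ring

theorem metric_comm (q u v : Sol) : metric q u v = metric q v u := by
  simp only [metric]; ring

theorem metric_add_left (q u u' v : Sol) : metric q (u + u') v = metric q u v + metric q u' v := by
  simp [metric]; ring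

theorem metric_smul_left (q : Sol) (c : ℝ) (u v : Sol) :
    metric q (c • u) v = c * metric q u v := by
  simp [metric]; ring

theorem metric_add_right (q u v v' : Sol) : metric q u (v + v') = metric q u v + metric q u v' := by
  simp [metric]; ring

theorem metric_smul_right (q : Sol) (c : ℝ) (u v : Sol) :
    metric q u (c • v) = c * metric q u v := by
  simp [metric]; ring

theorem metric_self_pos (q : Sol) {u : Sol} (hu : u ≠ 0) : 0 < metric q u u := by
  by_contra! h
  apply hu
  have h0 := mul_nonneg (Real.exp_pos (2 * q 2)).le (mul_self_nonneg (u 0))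
  have h1 := mul_nonneg (Real.exp_pos (-2 * q 2)).le (mul_self_nonneg (u 1))
  have h2 := mul_self_nonneg (u 2)
  simp only [metric] at h
  ext i
  fin_cases i
  · simpa using show Real.exp (2 * q 2) * (u 0 * u 0) = 0 by linarith
  · simpa using show Real.exp (-2 * q 2) * (u 1 * u 1) = 0 by linarith
  · simpa using show u 2 * u 2 = 0 by linarith

end Sol

namespace SolSurface

section Pointwise
variable {M : Type*} [TopologicalSpace M] [ChartedSpace (EuclideanSpace ℝ (Fin 2)) M]
variable (φ : M → Sol) (p : M)

theorem dmap_add (V : M → Sol) (X Y : TangentSpace (𝓡 2) p) :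
    dmap V p (X + Y) = dmap V p X + dmap V p Y :=
  map_add (mfderiv (𝓡 2) (𝓡 3) V p) X Y

theorem dmap_smul (V : M → Sol) (c : ℝ) (X : TangentSpace (𝓡 2) p) :
    dmap V p (c • X) = c • dmap V p X :=
  map_smul (mfderiv (𝓡 2) (𝓡 3) V p) c X

theorem dfun_add (u : M → ℝ) (X Y : TangentSpace (𝓡 2) p) :
    dfun u p (X + Y) = dfun u p X + dfun u p Y :=
  map_add (mfderiv (𝓡 2) 𝓘(ℝ, ℝ) u p) X Y

theorem dfun_smul (u : M → ℝ) (c : ℝ) (X : TangentSpace (𝓡 2) p) :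
    dfun u p (c • X) = c * dfun u p X :=
  map_smul (mfderiv (𝓡 2) 𝓘(ℝ, ℝ) u p) c X

theorem inducedMetric_comm (X Y : TangentSpace (𝓡 2) p) :
    inducedMetric φ p X Y = inducedMetric φ p Y X := Sol.metric_comm ..

theorem inducedMetric_add_left (X X' Y : TangentSpace (𝓡 2) p) :
    inducedMetric φ p (X + X') Y = inducedMetric φ p X Y + inducedMetric φ p X' Y := by
  simp only [inducedMetric, dmap_add, Sol.metric_add_left]

theorem inducedMetric_smul_left (c : ℝ) (X Y : TangentSpace (𝓡 2) p) :
    inducedMetric φ p (c • X) Y = c * inducedMetric φ p X Y := by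
  simp only [inducedMetric, dmap_smul, Sol.metric_smul_left]

theorem inducedMetric_add_right (X Y Y' : TangentSpace (𝓡 2) p) :
    inducedMetric φ p X (Y + Y') = inducedMetric φ p X Y + inducedMetric φ p X Y' := by
  simp only [inducedMetric, dmap_add, Sol.metric_add_right]

theorem inducedMetric_smul_right (c : ℝ) (X Y : TangentSpace (𝓡 2) p) :
    inducedMetric φ p X (c • Y) = c * inducedMetric φ p X Y := by
  simp only [inducedMetric, dmap_smul, Sol.metric_smul_right]

/-- The coordinates of a tangent vector in the basis `basisVec`. -/
def coord {p : M} (X : TangentSpace (𝓡 2) p) (i : Fin 2) : ℝ :=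
  (show EuclideanSpace ℝ (Fin 2) from X) i

theorem coord_spec {p : M} (X : TangentSpace (𝓡 2) p) :
    X = coord X 0 • basisVec p 0 + coord X 1 • basisVec p 1 := by
  have (x : EuclideanSpace ℝ (Fin 2)) : x = x 0 • EuclideanSpace.single 0 (1 : ℝ) +
      x 1 • EuclideanSpace.single 1 (1 : ℝ) := by
    ext i
    fin_cases i <;> simp
  exact this X

/-- Two tangent vectors that are orthonormal for the induced metric. -/
structure Orthonormal₂ (e₁ e₂ : TangentSpace (𝓡 2) p) : Prop where
  self₁ : inducedMetric φ p e₁ e₁ = 1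
  self₂ : inducedMetric φ p e₂ e₂ = 1
  orth : inducedMetric φ p e₁ e₂ = 0

variable {φ p} {e₁ e₂ : TangentSpace (𝓡 2) p}

/-- If the rows of X are the coordinates of an orthonormal basis and G is the Gram matrix, then X G
Xᵀ = 1, so XᵀX inverts G. Every contraction with the inverse Gram matrix thereby becomes a sum over
the orthonormal basis. -/
theorem Orthonormal₂.gram_inv_mul (he : Orthonormal₂ φ p e₁ e₂) :
    (Matrix.of fun i j => coord e₁ i * coord e₁ j + coord e₂ i * coord e₂ j) * gram φ p = 1 := by
  have hx : Matrix.of ![coord e₁, coord e₂] *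
      (gram φ p * (Matrix.of ![coord e₁, coord e₂]).transpose) = 1 := by
    have h1 := he.self₁
    have h2 := he.self₂
    have h3 := he.orth
    have h4 := he.orth
    rw [inducedMetric_comm] at h4
    rw [coord_spec e₁] at h1
    rw [coord_spec e₂] at h2
    rw [coord_spec e₁, coord_spec e₂] at h3 h4
    simp only [inducedMetric_add_left, inducedMetric_add_right, inducedMetric_smul_left,
      inducedMetric_smul_right] at h1 h2 h3 h4
    ext i j
    fin_cases i <;> fin_cases j <;>
      simp [Matrix.mul_apply, gram] <;>
      first
        | linear_combination h1 | linear_combination h2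
        | linear_combination h3 | linear_combination h4
  -- From X (G Xᵀ) = 1 to (G Xᵀ) X = 1, then to (XᵀX) G = 1.
  rw [mul_eq_one_comm, Matrix.mul_assoc, mul_eq_one_comm] at hx
  rw [← hx]
  congr 1
  ext i j
  simp [Matrix.mul_apply]

theorem Orthonormal₂.gram_inv (he : Orthonormal₂ φ p e₁ e₂) (i j : Fin 2) :
    (gram φ p)⁻¹ i j = coord e₁ i * coord e₁ j + coord e₂ i * coord e₂ j := by
  rw [Matrix.inv_eq_left_inv he.gram_inv_mul]; rfl

theorem Orthonormal₂.expand (he : Orthonormal₂ φ p e₁ e₂) (X : TangentSpace (𝓡 2) p) :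
    X = inducedMetric φ p X e₁ • e₁ + inducedMetric φ p X e₂ • e₂ := by
  have h := he.gram_inv_mul
  have h00 := congrFun (congrFun h 0) 0
  have h01 := congrFun (congrFun h 0) 1
  have h10 := congrFun (congrFun h 1) 0
  have h11 := congrFun (congrFun h 1) 1
  simp only [Matrix.mul_apply, Fin.sum_univ_two, Matrix.of_apply, gram] at h00 h01 h10 h11
  simp at h00 h01 h10 h11
  have key (e : TangentSpace (𝓡 2) p) : inducedMetric φ p X e =
      ∑ i, ∑ j, coord X i * coord e j * inducedMetric φ p (basisVec p j) (basisVec p i) := by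
    conv_lhs => rw [coord_spec X, coord_spec e]
    simp only [inducedMetric_add_left, inducedMetric_add_right, inducedMetric_smul_left,
      inducedMetric_smul_right, Fin.sum_univ_two]
    rw [inducedMetric_comm φ p (basisVec p 0) (basisVec p 1)]
    ring
  rw [key e₁, key e₂]
  simp only [Fin.sum_univ_two]
  refine (coord_spec X).trans (Eq.trans ?_ (congrArg₂ (· + ·)
    (congrArg (_ • ·) (coord_spec e₁).symm) (congrArg (_ • ·) (coord_spec e₂).symm)))
  match_scalars
  · linear_combination -coord X 0 * h00 - coord X 1 * h01
  · linear_combination -coord X 0 * h10 - coord X 1 * h11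

theorem Orthonormal₂.tangentPart_eq (he : Orthonormal₂ φ p e₁ e₂) (w : Sol) :
    tangentPart φ p w =
      Sol.metric (φ p) w (dmap φ p e₁) • e₁ + Sol.metric (φ p) w (dmap φ p e₂) • e₂ := by
  conv_rhs => rw [coord_spec e₁, coord_spec e₂]
  simp only [tangentPart, he.gram_inv, Fin.sum_univ_two, dmap_add, dmap_smul,
    Sol.metric_add_right, Sol.metric_smul_right]
  module

theorem Orthonormal₂.grad_eq (he : Orthonormal₂ φ p e₁ e₂) (u : M → ℝ) :
    grad φ u p = dfun u p e₁ • e₁ + dfun u p e₂ • e₂ := by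
  conv_rhs => rw [coord_spec e₁, coord_spec e₂]
  simp only [grad, he.gram_inv, Fin.sum_univ_two, dfun_add, dfun_smul]
  module

/-- Two linear maps are allowed so that one statement serves trace A and the divergence (second map
the identity) as well as |A|² and |∇A|². -/
theorem Orthonormal₂.metricTrace_eq (he : Orthonormal₂ φ p e₁ e₂)
    {L L' : TangentSpace (𝓡 2) p → TangentSpace (𝓡 2) p}
    (hL : IsLinearMap ℝ L) (hL' : IsLinearMap ℝ L') :
    metricTrace φ p (fun X Y => inducedMetric φ p (L X) (L' Y)) =
      inducedMetric φ p (L e₁) (L' e₁) + inducedMetric φ p (L e₂) (L' e₂) := by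
  conv_rhs => rw [coord_spec e₁, coord_spec e₂]
  simp only [metricTrace, he.gram_inv, Fin.sum_univ_two, hL.map_add, hL.map_smul, hL'.map_add,
    hL'.map_smul, inducedMetric_add_left, inducedMetric_add_right, inducedMetric_smul_left,
      inducedMetric_smul_right]
  ring

theorem Orthonormal₂.metricTrace_left (he : Orthonormal₂ φ p e₁ e₂)
    {L : TangentSpace (𝓡 2) p → TangentSpace (𝓡 2) p} (hL : IsLinearMap ℝ L) :
    metricTrace φ p (fun X Y => inducedMetric φ p (L X) Y) =
      inducedMetric φ p (L e₁) e₁ + inducedMetric φ p (L e₂) e₂ :=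
  he.metricTrace_eq hL (LinearMap.id : _ →ₗ[ℝ] TangentSpace (𝓡 2) p).isLinear

theorem metricTrace_add (B B' : TangentSpace (𝓡 2) p → TangentSpace (𝓡 2) p → ℝ) :
    metricTrace φ p (fun X Y => B X Y + B' X Y) = metricTrace φ p B + metricTrace φ p B' := by
  simp only [metricTrace, Fin.sum_univ_two]
  ring

end Pointwise
end SolSurface

/-! ### The ring of smooth functions on a chart domain and its coordinate derivations -/

namespace SolSurface
variable {M : Type*} [TopologicalSpace M] [ChartedSpace (EuclideanSpace ℝ (Fin 2)) M]

/-- The domain of the preferred chart at `p₀`. -/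
abbrev chartDomain (p₀ : M) : Set M := (chartAt (EuclideanSpace ℝ (Fin 2)) p₀).source

/-- Smoothness of a real function on the domain of the preferred chart at `p₀`. -/
abbrev SmoothNear (p₀ : M) (u : M → ℝ) : Prop :=
  ContMDiffOn (𝓡 2) 𝓘(ℝ, ℝ) ∞ u (chartDomain p₀)

/-- The real functions on the domain of the chart at `p₀` that are smooth there. -/
def smoothRing (p₀ : M) : Subalgebra ℝ (chartDomain p₀ → ℝ) where
  -- Elements are functions on the chart domain only, so equality in the ring is equality there; the
  -- extension v to all of M is what manifold derivatives can be applied to.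
  carrier := {u | ∃ v : M → ℝ, SmoothNear p₀ v ∧ ∀ q : chartDomain p₀, v q = u q}
  mul_mem' := by
    rintro _ _ ⟨v, hv, h⟩ ⟨w, hw, k⟩
    exact ⟨v * w, hv.mul hw, fun q => by simp [h, k]⟩
  add_mem' := by
    rintro _ _ ⟨v, hv, h⟩ ⟨w, hw, k⟩
    exact ⟨v + w, hv.add hw, fun q => by simp [h, k]⟩
  algebraMap_mem' c := ⟨fun _ => c, contMDiffOn_const, fun _ => rfl⟩

variable {p₀ : M}

/-- A function on all of `M` that extends an element of `smoothRing p₀`. -/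
def fn (r : smoothRing p₀) : M → ℝ := r.2.choose

theorem fn_smooth (r : smoothRing p₀) : SmoothNear p₀ (fn r) := r.2.choose_spec.1

theorem fn_coe (r : smoothRing p₀) (q : chartDomain p₀) : fn r q = (r : _ → ℝ) q :=
  r.2.choose_spec.2 q

/-- The element of `smoothRing p₀` defined by a function that is smooth on the chart domain. -/
def toRing (u : M → ℝ) (hu : SmoothNear p₀ u) : smoothRing p₀ :=
  ⟨fun q => u q, u, hu, fun _ => rfl⟩

theorem fn_toRing {q : M} (hq : q ∈ chartDomain p₀) {u : M → ℝ} (hu : SmoothNear p₀ u) :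
    fn (toRing u hu) q = u q :=
  fn_coe (toRing u hu) ⟨q, hq⟩

theorem ring_ext {r s : smoothRing p₀} (h : ∀ q ∈ chartDomain p₀, fn r q = fn s q) : r = s := by
  ext q
  rw [← fn_coe, ← fn_coe, h q q.2]

/-- Evaluation at a point of the chart domain. -/
def ev {q : M} (hq : q ∈ chartDomain p₀) : smoothRing p₀ →ₐ[ℝ] ℝ :=
  (Pi.evalAlgHom ℝ _ (⟨q, hq⟩ : chartDomain p₀)).comp (smoothRing p₀).val

theorem fn_eq_ev {q : M} (hq : q ∈ chartDomain p₀) (r : smoothRing p₀) : fn r q = ev hq r :=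
  fn_coe r ⟨q, hq⟩

theorem chartDomain_mem_nhds {q : M} (hq : q ∈ chartDomain p₀) : chartDomain p₀ ∈ nhds q :=
  (chartAt (EuclideanSpace ℝ (Fin 2)) p₀).open_source.mem_nhds hq

/-- The differential depends only on the germ and the chart domain is open, so the arbitrary
extension chosen in `fn` does not affect derivatives at its points. -/
theorem dfun_congr {u v : M → ℝ} (h : ∀ q ∈ chartDomain p₀, u q = v q) {q : M}
    (hq : q ∈ chartDomain p₀) (X : TangentSpace (𝓡 2) q) : dfun u q X = dfun v q X := by
  have : u =ᶠ[nhds q] v := Filter.eventuallyEq_of_mem (chartDomain_mem_nhds hq) h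
  simp only [dfun]
  have := this.mfderiv_eq (I := 𝓡 2) (I' := 𝓘(ℝ, ℝ))
  exact congrArg (fun L : EuclideanSpace ℝ (Fin 2) →L[ℝ] ℝ => L X) this

theorem SmoothNear.mdiff {u : M → ℝ} (hu : SmoothNear p₀ u) {q : M} (hq : q ∈ chartDomain p₀) :
    MDifferentiableAt (𝓡 2) 𝓘(ℝ, ℝ) u q :=
  (hu.contMDiffAt (chartDomain_mem_nhds hq)).mdifferentiableAt (by simp)

section Calculus
variable {u v : M → ℝ} {q : M}

theorem dfun_fun_add (hu : MDifferentiableAt (𝓡 2) 𝓘(ℝ, ℝ) u q)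
    (hv : MDifferentiableAt (𝓡 2) 𝓘(ℝ, ℝ) v q) (X : TangentSpace (𝓡 2) q) :
    dfun (fun q => u q + v q) q X = dfun u q X + dfun v q X := by
  have := (hu.hasMFDerivAt.add hv.hasMFDerivAt).mfderiv
  exact congrArg (fun L : EuclideanSpace ℝ (Fin 2) →L[ℝ] ℝ => L X) this

theorem dfun_fun_mul (hu : MDifferentiableAt (𝓡 2) 𝓘(ℝ, ℝ) u q)
    (hv : MDifferentiableAt (𝓡 2) 𝓘(ℝ, ℝ) v q) (X : TangentSpace (𝓡 2) q) :
    dfun (fun q => u q * v q) q X = u q * dfun v q X + v q * dfun u q X := by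
  have := (hu.hasMFDerivAt.mul hv.hasMFDerivAt).mfderiv
  exact congrArg (fun L : EuclideanSpace ℝ (Fin 2) →L[ℝ] ℝ => L X) this

theorem dfun_const (c : ℝ) (X : TangentSpace (𝓡 2) q) : dfun (fun _ : M => c) q X = 0 := by
  have := mfderiv_const (I := 𝓡 2) (I' := 𝓘(ℝ, ℝ)) (x := q) (c := c)
  exact congrArg (fun L : EuclideanSpace ℝ (Fin 2) →L[ℝ] ℝ => L X) this

theorem dfun_comp {F : ℝ → ℝ} {F' : ℝ} (hF : HasDerivAt F F' (u q))
    (hu : MDifferentiableAt (𝓡 2) 𝓘(ℝ, ℝ) u q)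
    (X : TangentSpace (𝓡 2) q) : dfun (fun q => F (u q)) q X = F' * dfun u q X := by
  have := (HasMFDerivAt.comp q hF.hasFDerivAt.hasMFDerivAt hu.hasMFDerivAt).mfderiv
  refine (congrArg (fun L : EuclideanSpace ℝ (Fin 2) →L[ℝ] ℝ => L X) this).trans ?_
  exact (ContinuousLinearMap.toSpanSingleton_apply ..).trans (mul_comm _ _)

theorem dmap_apply {V : M → Sol} (hV : MDifferentiableAt (𝓡 2) (𝓡 3) V q)
    (X : TangentSpace (𝓡 2) q) (i : Fin 3) : dmap V q X i = dfun (fun q => V q i) q X := by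
  have h := (EuclideanSpace.proj i : Sol →L[ℝ] ℝ).hasFDerivAt (x := V q)
  have := (HasMFDerivAt.comp q h.hasMFDerivAt hV.hasMFDerivAt).mfderiv
  exact (congrArg (fun L : EuclideanSpace ℝ (Fin 2) →L[ℝ] ℝ => L X) this).symm
end Calculus

variable [IsManifold (𝓡 2) ∞ M]

/-- The tangent bundle trivialization at p₀ is the differential of the chart, and the identity on
the fibre at p₀. So `ext v` is the field with constant coordinates v in that chart. -/
theorem ext_eq (v : TangentSpace (𝓡 2) p₀) {q : M} (hq : q ∈ chartDomain p₀) :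
    ext v q = mfderiv (𝓡 2) (𝓡 2) (chartAt (EuclideanSpace ℝ (Fin 2)) p₀).symm
      (chartAt (EuclideanSpace ℝ (Fin 2)) p₀ q) (show EuclideanSpace ℝ (Fin 2) from v) := by
  have : IsManifold (𝓡 2) 1 M := IsManifold.of_le (n := ∞) (by simp)
  have h := TangentBundle.symmL_trivializationAt (I := 𝓡 2) hq
  have h' := TangentBundle.continuousLinearMapAt_trivializationAt (I := 𝓡 2)
    (mem_chart_source _ p₀)
  rw [mfderiv_extChartAt_self] at h'
  have hv := congrArg (fun L : EuclideanSpace ℝ (Fin 2) →L[ℝ] EuclideanSpace ℝ (Fin 2) => L v) h'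
  have h₁ := congrArg (fun L : EuclideanSpace ℝ (Fin 2) →L[ℝ] EuclideanSpace ℝ (Fin 2) => L v) h
  have h₂ : (trivializationAt (EuclideanSpace ℝ (Fin 2)) (TangentSpace (𝓡 2)) p₀ ⟨p₀, v⟩).2 = v :=
    (Bundle.Trivialization.continuousLinearMapAt_apply_of_mem _
      (hb := FiberBundle.mem_baseSet_trivializationAt' p₀) ..).symm.trans hv
  simp only [mfld_simps, mfderivWithin_univ] at h₁
  simp only [ext, FiberBundle.extend, h₂]
  exact (Bundle.Trivialization.symmL_apply _ (hb := by simpa using hq) ..).symm.trans h₁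

theorem ext_add (v w : TangentSpace (𝓡 2) p₀) {q : M} (hq : q ∈ chartDomain p₀) :
    ext (v + w) q = ext v q + ext w q := by
  rw [ext_eq _ hq, ext_eq _ hq, ext_eq _ hq]
  exact map_add (mfderiv (𝓡 2) (𝓡 2) (chartAt (EuclideanSpace ℝ (Fin 2)) p₀).symm
    (chartAt (EuclideanSpace ℝ (Fin 2)) p₀ q)) _ _

theorem ext_smul (c : ℝ) (v : TangentSpace (𝓡 2) p₀) {q : M} (hq : q ∈ chartDomain p₀) :
    ext (c • v) q = c • ext v q := by
  rw [ext_eq _ hq, ext_eq _ hq]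
  exact map_smul (mfderiv (𝓡 2) (𝓡 2) (chartAt (EuclideanSpace ℝ (Fin 2)) p₀).symm
    (chartAt (EuclideanSpace ℝ (Fin 2)) p₀ q)) _ _

theorem ext_self (v : TangentSpace (𝓡 2) p₀) : ext v p₀ = v := by
  simp [ext]

theorem ext_eq_zero_iff (v : TangentSpace (𝓡 2) p₀) {q : M} (hq : q ∈ chartDomain p₀) :
    ext v q = 0 ↔ v = 0 := by
  have : IsManifold (𝓡 2) 1 M := IsManifold.of_le (n := ∞) (by simp)
  rw [ext_eq _ hq]
  have := (mdifferentiable_chart (I := 𝓡 2) p₀).symm.mfderiv_injective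
    ((chartAt (EuclideanSpace ℝ (Fin 2)) p₀).map_source hq)
  exact (injective_iff_map_eq_zero' (mfderiv (𝓡 2) (𝓡 2)
    (chartAt (EuclideanSpace ℝ (Fin 2)) p₀).symm _)).1 this v

/-- The expression of a function in the chart at `p₀`. -/
def inChart (p₀ : M) (u : M → ℝ) (x : EuclideanSpace ℝ (Fin 2)) : ℝ :=
  u ((chartAt (EuclideanSpace ℝ (Fin 2)) p₀).symm x)

theorem SmoothNear.contDiffOn {u : M → ℝ} (hu : SmoothNear p₀ u) :
    ContDiffOn ℝ ∞ (inChart p₀ u) (chartAt (EuclideanSpace ℝ (Fin 2)) p₀).target := by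
  have h := contMDiffOn_chart_symm (I := 𝓡 2) (n := ∞) (x := p₀)
  exact (hu.comp h (fun x hx => (chartAt (EuclideanSpace ℝ (Fin 2)) p₀).map_target hx)).contDiffOn

theorem dfun_ext {u : M → ℝ} (hu : SmoothNear p₀ u) (v : TangentSpace (𝓡 2) p₀) {q : M}
    (hq : q ∈ chartDomain p₀) : dfun u q (ext v q) =
      fderiv ℝ (inChart p₀ u) (chartAt (EuclideanSpace ℝ (Fin 2)) p₀ q)
        (show EuclideanSpace ℝ (Fin 2) from v) := by
  have : IsManifold (𝓡 2) 1 M := IsManifold.of_le (n := ∞) (by simp)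
  have hs := (mdifferentiable_chart (I := 𝓡 2) p₀).mdifferentiableAt_symm
    ((chartAt (EuclideanSpace ℝ (Fin 2)) p₀).map_source hq)
  have hu' := hu.mdiff hq
  rw [← (chartAt (EuclideanSpace ℝ (Fin 2)) p₀).left_inv hq] at hu'
  have h := mfderiv_comp _ hu' hs
  rw [mfderiv_eq_fderiv, (chartAt (EuclideanSpace ℝ (Fin 2)) p₀).left_inv hq] at h
  rw [ext_eq _ hq]
  exact (congrArg (fun L : EuclideanSpace ℝ (Fin 2) →L[ℝ] ℝ => L v) h).symm

theorem smoothNear_dfun_ext {u : M → ℝ} (hu : SmoothNear p₀ u) (v : TangentSpace (𝓡 2) p₀) :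
    SmoothNear p₀ (fun q => dfun u q (ext v q)) := by
  have h : ContDiffOn ℝ ∞ (fun x => fderiv ℝ (inChart p₀ u) x
      (show EuclideanSpace ℝ (Fin 2) from v)) (chartAt (EuclideanSpace ℝ (Fin 2)) p₀).target :=
    (hu.contDiffOn.fderiv_of_isOpen (chartAt (EuclideanSpace ℝ (Fin 2)) p₀).open_target
      (by simp)).clm_apply contDiffOn_const
  have h' := h.contMDiffOn.comp (contMDiffOn_chart (I := 𝓡 2) (n := ∞) (x := p₀))
    (fun q hq => (chartAt (EuclideanSpace ℝ (Fin 2)) p₀).map_source hq)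
  exact h'.congr fun q hq => dfun_ext hu v hq

theorem fderiv_apply_const {E F : Type*} [NormedAddCommGroup E] [NormedSpace ℝ E]
    [NormedAddCommGroup F] [NormedSpace ℝ F] {G : E → E →L[ℝ] F} {x : E}
    (hG : DifferentiableAt ℝ G x) (v w : E) :
    fderiv ℝ (fun x => G x v) x w = fderiv ℝ G x w v := by
  rw [fderiv_clm_apply hG (differentiableAt_const _)]
  simp

/-- Read in the chart, both sides are second directional derivatives along constant vectors, so this
is the symmetry of the second derivative. -/
theorem dfun_dfun_ext_comm {u : M → ℝ} (hu : SmoothNear p₀ u) (v w : TangentSpace (𝓡 2) p₀)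
    {q : M} (hq : q ∈ chartDomain p₀) :
    dfun (fun q => dfun u q (ext v q)) q (ext w q) =
      dfun (fun q => dfun u q (ext w q)) q (ext v q) := by
  have hx := (chartAt (EuclideanSpace ℝ (Fin 2)) p₀).map_source hq
  have hn := (chartAt (EuclideanSpace ℝ (Fin 2)) p₀).open_target.mem_nhds hx
  have hd := (hu.contDiffOn.fderiv_of_isOpen (m := ∞)
    (chartAt (EuclideanSpace ℝ (Fin 2)) p₀).open_target (by simp)).contDiffAt hn
  have key (v w : TangentSpace (𝓡 2) p₀) :
      dfun (fun q => dfun u q (ext v q)) q (ext w q) =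
      fderiv ℝ (fderiv ℝ (inChart p₀ u)) (chartAt (EuclideanSpace ℝ (Fin 2)) p₀ q)
        (show EuclideanSpace ℝ (Fin 2) from w) (show EuclideanSpace ℝ (Fin 2) from v) := by
    rw [dfun_ext (smoothNear_dfun_ext hu _) _ hq]
    have : inChart p₀ (fun q => dfun u q (ext v q)) =ᶠ[nhds
        (chartAt (EuclideanSpace ℝ (Fin 2)) p₀ q)] fun x => fderiv ℝ (inChart p₀ u) x
          (show EuclideanSpace ℝ (Fin 2) from v) := by
      filter_upwards [hn] with x hx
      simp only [inChart]
      rw [dfun_ext hu v ((chartAt (EuclideanSpace ℝ (Fin 2)) p₀).map_target hx),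
        (chartAt (EuclideanSpace ℝ (Fin 2)) p₀).right_inv hx]
    rw [this.fderiv_eq]
    exact fderiv_apply_const (hd.differentiableAt (by simp)) _ _
  have hsymm := (hu.contDiffOn.contDiffAt hn).isSymmSndFDerivAt
    (by simpa using ENat.LEInfty.out)
  exact (key v w).trans ((hsymm.eq _ _).trans (key w v).symm)

/-- The derivation of `smoothRing p₀` given by a coordinate vector field. -/
def coordDeriv (v : TangentSpace (𝓡 2) p₀) : Derivation ℝ (smoothRing p₀) (smoothRing p₀) :=
  Derivation.mk'
    { toFun := fun u => toRing _ (smoothNear_dfun_ext (fn_smooth u) v)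
      map_add' := fun u w => by
        refine ring_ext fun q hq => ?_
        rw [fn_eq_ev hq (_ + _), map_add]
        simp only [← fn_eq_ev, fn_toRing hq]
        rw [← dfun_fun_add ((fn_smooth u).mdiff hq) ((fn_smooth w).mdiff hq)]
        exact dfun_congr (fun q hq => by simp [fn_eq_ev hq]) hq _
      map_smul' := fun c u => by
        refine ring_ext fun q hq => ?_
        rw [fn_eq_ev hq (_ • _), RingHom.id_apply, map_smul]
        simp only [← fn_eq_ev, fn_toRing hq, smul_eq_mul]
        have h := dfun_fun_mul (u := fun _ => c) (q := q) mdifferentiableAt_const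
          ((fn_smooth u).mdiff hq) (ext v q)
        rw [dfun_const, mul_zero, add_zero] at h
        rw [← h]
        exact dfun_congr (fun q hq => by simp [fn_eq_ev hq]) hq _ }
    fun u w => by
      refine ring_ext fun q hq => ?_
      rw [fn_eq_ev hq (_ + _), map_add]
      simp only [smul_eq_mul, map_mul, LinearMap.coe_mk, AddHom.coe_mk]
      simp only [← fn_eq_ev, fn_toRing hq]
      rw [← dfun_fun_mul ((fn_smooth u).mdiff hq) ((fn_smooth w).mdiff hq)]
      exact dfun_congr (fun q hq => by simp [fn_eq_ev hq]) hq _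

theorem fn_coordDeriv (v : TangentSpace (𝓡 2) p₀) (r : smoothRing p₀) {q : M}
    (hq : q ∈ chartDomain p₀) : fn (coordDeriv v r) q = dfun (fn r) q (ext v q) :=
  fn_toRing hq (smoothNear_dfun_ext (fn_smooth r) v)

theorem coordDeriv_toRing (v : TangentSpace (𝓡 2) p₀) {u : M → ℝ} (hu : SmoothNear p₀ u) :
    coordDeriv v (toRing u hu) = toRing _ (smoothNear_dfun_ext hu v) := by
  refine ring_ext fun q hq => ?_
  rw [fn_coordDeriv _ _ hq, fn_toRing hq]
  exact dfun_congr (fun q hq => fn_toRing hq _) hq _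

theorem coordDeriv_comm (v w : TangentSpace (𝓡 2) p₀) (r : smoothRing p₀) :
    coordDeriv v (coordDeriv w r) = coordDeriv w (coordDeriv v r) := by
  refine ring_ext fun q hq => ?_
  have (v w : TangentSpace (𝓡 2) p₀) : fn (coordDeriv v (coordDeriv w r)) q =
      dfun (fun q => dfun (fn r) q (ext w q)) q (ext v q) := by
    rw [fn_coordDeriv _ _ hq]
    exact dfun_congr (fun q hq => fn_coordDeriv _ _ hq) hq _
  rw [this, this, dfun_dfun_ext_comm (fn_smooth r) _ _ hq]

theorem lieBracketWithin_eq_zero_of_eventuallyEq_const {E : Type*} [NormedAddCommGroup E]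
    [NormedSpace ℝ E] {V W : E → E} {v w x : E} (hV : V =ᶠ[nhds x] fun _ => v)
    (hW : W =ᶠ[nhds x] fun _ => w) : VectorField.lieBracketWithin ℝ V W Set.univ x = 0 := by
  rw [VectorField.lieBracketWithin_univ, VectorField.lieBracket, hV.fderiv_eq, hW.fderiv_eq]
  simp

/-- In the chart both fields are constant. This kills the bracket term in the definition of the
Gaussian curvature. -/
theorem mlieBracket_ext (v w : TangentSpace (𝓡 2) p₀) :
    VectorField.mlieBracket (𝓡 2) (fun q => ext v q) (fun q => ext w q) p₀ = 0 := by
  have hM : IsManifold (𝓡 2) 1 M := IsManifold.of_le (n := ∞) (by simp)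
  have hn : (extChartAt (𝓡 2) p₀).target ∈ nhds (extChartAt (𝓡 2) p₀ p₀) :=
    extChartAt_target_mem_nhds p₀
  have key (v : TangentSpace (𝓡 2) p₀) :
      (VectorField.mpullbackWithin 𝓘(ℝ, EuclideanSpace ℝ (Fin 2)) (𝓡 2)
        (extChartAt (𝓡 2) p₀).symm (fun q => ext v q) (Set.range (𝓡 2)) :
          EuclideanSpace ℝ (Fin 2) → EuclideanSpace ℝ (Fin 2)) =ᶠ[nhds (extChartAt (𝓡 2) p₀ p₀)]
      fun _ => (show EuclideanSpace ℝ (Fin 2) from v) := by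
    filter_upwards [hn] with x hx
    have hx' : x ∈ (chartAt (EuclideanSpace ℝ (Fin 2)) p₀).target := by simpa using hx
    have h := ext_eq v ((chartAt (EuclideanSpace ℝ (Fin 2)) p₀).map_target hx')
    rw [(chartAt (EuclideanSpace ℝ (Fin 2)) p₀).right_inv hx'] at h
    have hi := isInvertible_mfderivWithin_extChartAt_symm (I := 𝓡 2) hx
    rw [VectorField.mpullbackWithin_apply]
    have h₁ : ext v ((extChartAt (𝓡 2) p₀).symm x) =
        mfderivWithin 𝓘(ℝ, EuclideanSpace ℝ (Fin 2)) (𝓡 2) (extChartAt (𝓡 2) p₀).symm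
          (Set.range (𝓡 2)) x (show EuclideanSpace ℝ (Fin 2) from v) := by
      simp only [mfld_simps, mfderivWithin_univ]
      exact h
    rw [h₁]
    exact hi.inverse_apply_eq.2 rfl
  rw [← VectorField.mlieBracketWithin_univ, VectorField.mlieBracketWithin_apply]
  refine (congrArg _ ?_).trans (map_zero (mfderiv (𝓡 2) 𝓘(ℝ, EuclideanSpace ℝ (Fin 2))
    (extChartAt (𝓡 2) p₀) p₀).inverse)
  have hs : (extChartAt (𝓡 2) p₀).symm ⁻¹' Set.univ ∩ Set.range (𝓡 2) = Set.univ := by simp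
  rw [hs]
  exact lieBracketWithin_eq_zero_of_eventuallyEq_const (key v) (key w)

end SolSurface

/-! ### Gram–Schmidt: from coordinate fields to an orthonormal frame -/

/-- Two commuting derivations and the components of the corresponding coordinate fields of a
surface in `Sol₃`, its unit normal, and the coefficients of the Gram–Schmidt process. -/
structure SolChart (R : Type*) [CommRing R] [Algebra ℝ R] where
  d₀ : Derivation ℝ R R
  d₁ : Derivation ℝ R R
  comm : ∀ u, d₀ (d₁ u) = d₁ (d₀ u)
  β₀ : Fin 3 → R
  β₁ : Fin 3 → R
  n : Fin 3 → R
  torsion : ∀ m, d₀ (β₁ m) + solGamma β₀ β₁ m = d₁ (β₀ m) + solGamma β₁ β₀ m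
  nn : dot n n = 1
  nβ₀ : dot n β₀ = 0
  nβ₁ : dot n β₁ = 0
  s₁ : R
  s₂ : R
  hs₁ : s₁ ^ 2 * dot β₀ β₀ = 1
  hs₂ : s₂ ^ 2 * (dot β₁ β₁ - dot β₀ β₁ ^ 2 * s₁ ^ 2) = 1

namespace SolChart
variable {R : Type*} [CommRing R] [Algebra ℝ R] (C : SolChart R)

/-- The coefficient of the first coordinate field in the second vector of the frame. -/
def s₂₀ : R := -(C.s₂ * dot C.β₀ C.β₁ * C.s₁ ^ 2)

/-- The component of the first coordinate field in the orthonormal frame. -/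
def t₀₀ : R := C.s₁ * dot C.β₀ C.β₀

/-- The first component of the second coordinate field in the orthonormal frame. -/
def t₁₀ : R := C.s₁ * dot C.β₀ C.β₁

/-- The second component of the second coordinate field in the orthonormal frame. -/
def t₁₁ : R := C.s₂ * (dot C.β₁ C.β₁ - dot C.β₀ C.β₁ ^ 2 * C.s₁ ^ 2)

theorem t₀₀_s₁ : C.t₀₀ * C.s₁ = 1 := by
  have := C.hs₁; simp only [t₀₀]; linear_combination this

theorem t₁₁_s₂ : C.t₁₁ * C.s₂ = 1 := by
  have := C.hs₂; simp only [t₁₁]; linear_combination this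

theorem t₁₀_s₁ : C.t₁₀ * C.s₁ + C.t₁₁ * C.s₂₀ = 0 := by
  have := C.hs₂; simp only [t₁₀, t₁₁, s₂₀]
  linear_combination -dot C.β₀ C.β₁ * C.s₁ ^ 2 * this

/-- The orthonormal frame obtained from the coordinate fields. -/
def frame : SolFrame R where
  D₁ := C.s₁ • C.d₀
  D₂ := C.s₂ • C.d₁ + C.s₂₀ • C.d₀
  a := fun m => C.s₁ * C.β₀ m
  b := fun m => C.s₂ * C.β₁ m + C.s₂₀ * C.β₀ m
  n := C.n
  aa := by
    have h := C.hs₁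
    simp only [dot] at *
    linear_combination h
  bb := by
    have h := C.hs₁
    have h' := C.hs₂
    simp only [dot, s₂₀] at *
    linear_combination h' + C.s₂ ^ 2 * (C.β₀ 0 * C.β₁ 0 + C.β₀ 1 * C.β₁ 1 + C.β₀ 2 * C.β₁ 2) ^ 2
      * C.s₁ ^ 2 * h
  nn := C.nn
  ab := by
    have h := C.hs₁
    simp only [dot, s₂₀] at *
    linear_combination -C.s₂ * C.s₁ * (C.β₀ 0 * C.β₁ 0 + C.β₀ 1 * C.β₁ 1 + C.β₀ 2 * C.β₁ 2) * h
  an := by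
    have h := C.nβ₀
    simp only [dot] at *
    linear_combination C.s₁ * h
  bn := by
    have h := C.nβ₀
    have h' := C.nβ₁
    simp only [dot] at *
    linear_combination C.s₂₀ * h + C.s₂ * h'
  -- As d₀ and d₁ commute, [D₁, D₂] only involves derivatives of the Gram–Schmidt coefficients; k₁
  -- and k₂ arise by rewriting it with d₀ = t₀₀ D₁ and d₁ = t₁₀ D₁ + t₁₁ D₂.
  k₁ := (C.s₁ * C.d₀ C.s₂₀ - (C.s₂ * C.d₁ C.s₁ + C.s₂₀ * C.d₀ C.s₁)) * C.t₀₀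
    + C.s₁ * C.d₀ C.s₂ * C.t₁₀
  k₂ := C.s₁ * C.d₀ C.s₂ * C.t₁₁
  comm u := by
    have h0 := C.t₀₀_s₁
    have h1 := C.t₁₁_s₂
    have h2 := C.t₁₀_s₁
    simp only [Derivation.add_apply, Derivation.smul_apply, smul_eq_mul, map_add,
      Derivation.leibniz, C.comm]
    linear_combination -(C.s₁ * C.d₀ C.s₂₀ - (C.s₂ * C.d₁ C.s₁ + C.s₂₀ * C.d₀ C.s₁)) * C.d₀ u * h0
      - C.s₁ * C.d₀ C.s₂ * C.d₁ u * h1 - C.s₁ * C.d₀ C.s₂ * C.d₀ u * h2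
  torsion m := by
    have h0 := C.t₀₀_s₁
    have h1 := C.t₁₁_s₂
    have h2 := C.t₁₀_s₁
    -- The antisymmetrized symbols are alternating, so the s₂₀ contribution drops out.
    have h3 : solGamma (fun m => C.s₁ * C.β₀ m) (fun m => C.s₂ * C.β₁ m + C.s₂₀ * C.β₀ m) m -
      solGamma (fun m => C.s₂ * C.β₁ m + C.s₂₀ * C.β₀ m) (fun m => C.s₁ * C.β₀ m) m =
      C.s₁ * C.s₂ * (solGamma C.β₀ C.β₁ m - solGamma C.β₁ C.β₀ m) := by
      fin_cases m <;> simp [solGamma] <;> ring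
    simp only [Derivation.add_apply, Derivation.smul_apply, smul_eq_mul, map_add,
      Derivation.leibniz]
    linear_combination h3 + C.s₁ * C.s₂ * C.torsion m
      - (C.s₁ * C.d₀ C.s₂₀ - (C.s₂ * C.d₁ C.s₁ + C.s₂₀ * C.d₀ C.s₁)) * C.β₀ m * h0
      - C.s₁ * C.d₀ C.s₂ * C.β₁ m * h1 - C.s₁ * C.d₀ C.s₂ * C.β₀ m * h2

end SolChart

/-! ### The chart data of an immersed surface -/

namespace SolSurface
variable {M : Type*} [TopologicalSpace M] [ChartedSpace (EuclideanSpace ℝ (Fin 2)) M]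

/-- The hypotheses on the immersion `φ` and its unit normal `ξ`. -/
structure IsSurface (φ ξ : M → Sol) : Prop where
  smooth : ContMDiff (𝓡 2) (𝓡 3) ∞ φ
  imm : ∀ p : M, Function.Injective (mfderiv (𝓡 2) (𝓡 3) φ p)
  smooth_normal : ContMDiff (𝓡 2) (𝓡 3) ∞ ξ
  unit : ∀ p : M, Sol.metric (φ p) (ξ p) (ξ p) = 1
  normal : ∀ (p : M) (X : TangentSpace (𝓡 2) p), Sol.metric (φ p) (ξ p) (dmap φ p X) = 0

theorem smoothNear_coord {V : M → Sol} (hV : ContMDiff (𝓡 2) (𝓡 3) ∞ V) (p₀ : M) (m : Fin 3) :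
    SmoothNear p₀ (fun q => V q m) :=
  ((EuclideanSpace.proj m : Sol →L[ℝ] ℝ).contMDiff.comp hV).contMDiffOn

theorem smoothNear_comp {F : ℝ → ℝ} {s : Set ℝ} (hF : ContDiffOn ℝ ∞ F s) {p₀ : M} {u : M → ℝ}
    (hu : SmoothNear p₀ u) (hs : ∀ q ∈ chartDomain p₀, u q ∈ s) :
    SmoothNear p₀ (fun q => F (u q)) :=
  hF.contMDiffOn.comp hu hs

theorem fn_dot {p₀ q : M} (hq : q ∈ chartDomain p₀) (u v : Fin 3 → smoothRing p₀) :
    fn (dot u v) q = dot (fun m => fn (u m) q) (fun m => fn (v m) q) := by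
  simp [dot, fn_eq_ev hq]

theorem IsSurface.inducedMetric_self_pos {φ ξ : M → Sol} (h : IsSurface φ ξ) {q : M}
    {X : TangentSpace (𝓡 2) q} (hX : X ≠ 0) : 0 < inducedMetric φ q X X := by
  refine Sol.metric_self_pos _ fun h0 => hX ?_
  exact h.imm q (h0.trans (map_zero (mfderiv (𝓡 2) (𝓡 3) φ q)).symm)

theorem single_one_add_smul_ne_zero (c : ℝ) :
    EuclideanSpace.single (1 : Fin 2) (1 : ℝ) + c • EuclideanSpace.single (0 : Fin 2) (1 : ℝ) ≠
      0 := fun h => by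
  simpa using congrFun (congrArg WithLp.ofLp h) 1

/-- The function `1 / √u`. -/
def invSqrt {p₀ : M} (u : smoothRing p₀) (hu : ∀ q ∈ chartDomain p₀, 0 < fn u q) :
    smoothRing p₀ :=
  toRing (fun q => (√(fn u q))⁻¹) (smoothNear_comp (F := fun t => (√t)⁻¹) (s := Set.Ioi 0)
    (fun _ ht => ((Real.contDiffAt_sqrt (ne_of_gt ht)).inv
      (Real.sqrt_ne_zero'.2 ht)).contDiffWithinAt) (fn_smooth u) hu)

theorem invSqrt_sq_mul {p₀ : M} (u : smoothRing p₀) (hu : ∀ q ∈ chartDomain p₀, 0 < fn u q) :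
    invSqrt u hu ^ 2 * u = 1 := by
  refine ring_ext fun q hq => ?_
  rw [fn_eq_ev hq, fn_eq_ev hq, map_mul, map_pow, map_one, ← fn_eq_ev, ← fn_eq_ev, invSqrt,
    fn_toRing hq, inv_pow, Real.sq_sqrt (hu q hq).le]
  exact inv_mul_cancel₀ (hu q hq).ne'

namespace IsSurface
variable {φ ξ : M → Sol} (h : IsSurface φ ξ) (p₀ : M)

/-- The coordinates of the immersion. -/
def x (m : Fin 3) : smoothRing p₀ := toRing (fun q => φ q m) (smoothNear_coord h.smooth p₀ m)

/-- The function `e^z` along the surface. -/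
def expPos : smoothRing p₀ := toRing (fun q => Real.exp (φ q 2)) (smoothNear_comp
  Real.contDiff_exp.contDiffOn (smoothNear_coord h.smooth p₀ 2) (fun _ _ => Set.mem_univ _))

/-- The function `e^{-z}` along the surface. -/
def expNeg : smoothRing p₀ := toRing (fun q => Real.exp (-φ q 2)) (smoothNear_comp
  (F := fun t => Real.exp (-t)) (Real.contDiff_exp.comp contDiff_neg).contDiffOn
  (smoothNear_coord h.smooth p₀ 2) (fun _ _ => Set.mem_univ _))

/-- The components of the unit normal. -/
def n : Fin 3 → smoothRing p₀ :=
  ![h.expPos p₀ * toRing _ (smoothNear_coord h.smooth_normal p₀ 0),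
    h.expNeg p₀ * toRing _ (smoothNear_coord h.smooth_normal p₀ 1),
    toRing _ (smoothNear_coord h.smooth_normal p₀ 2)]

variable {p₀} in
theorem fn_n {q : M} (hq : q ∈ chartDomain p₀) (m : Fin 3) :
    fn (h.n p₀ m) q = Sol.comp (φ q) (ξ q) m := by
  fin_cases m <;> simp only [n, expPos, expNeg, Sol.comp] <;>
    simp [fn_eq_ev hq] <;> simp [← fn_eq_ev hq, fn_toRing hq]

variable [IsManifold (𝓡 2) ∞ M]

/-- The components of the coordinate fields. -/
def β (i : Fin 2) : Fin 3 → smoothRing p₀ :=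
  ![h.expPos p₀ * coordDeriv (basisVec p₀ i) (h.x p₀ 0),
    h.expNeg p₀ * coordDeriv (basisVec p₀ i) (h.x p₀ 1), coordDeriv (basisVec p₀ i) (h.x p₀ 2)]

variable {p₀}

theorem fn_coordDeriv_x {q : M} (hq : q ∈ chartDomain p₀) (v : TangentSpace (𝓡 2) p₀) (m : Fin 3) :
    fn (coordDeriv v (h.x p₀ m)) q = dmap φ q (ext v q) m := by
  rw [x, coordDeriv_toRing, fn_toRing hq, dmap_apply (h.smooth.mdifferentiableAt (by simp))]

theorem fn_β {q : M} (hq : q ∈ chartDomain p₀) (i : Fin 2) (m : Fin 3) :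
    fn (h.β p₀ i m) q = Sol.comp (φ q) (dmap φ q (ext (basisVec p₀ i) q)) m := by
  fin_cases m <;> simp only [β, Sol.comp] <;>
    simp [fn_eq_ev hq] <;> simp [← fn_eq_ev hq, fn_coordDeriv_x h hq, expPos, expNeg, fn_toRing hq]

theorem coordDeriv_expPos (v : TangentSpace (𝓡 2) p₀) :
    coordDeriv v (h.expPos p₀) = h.expPos p₀ * coordDeriv v (h.x p₀ 2) := by
  refine ring_ext fun q hq => ?_
  rw [fn_eq_ev hq (_ * _), map_mul, ← fn_eq_ev, ← fn_eq_ev]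
  simp only [expPos, x, coordDeriv_toRing, fn_toRing hq]
  exact dfun_comp (Real.hasDerivAt_exp _) ((smoothNear_coord h.smooth p₀ 2).mdiff hq) _

theorem coordDeriv_expNeg (v : TangentSpace (𝓡 2) p₀) :
    coordDeriv v (h.expNeg p₀) = -(h.expNeg p₀ * coordDeriv v (h.x p₀ 2)) := by
  refine ring_ext fun q hq => ?_
  rw [fn_eq_ev hq (-(_ * _)), map_neg, map_mul, ← fn_eq_ev, ← fn_eq_ev]
  simp only [expNeg, x, coordDeriv_toRing, fn_toRing hq]
  refine (dfun_comp (F := fun t => Real.exp (-t)) ((hasDerivAt_neg _).exp)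
    ((smoothNear_coord h.smooth p₀ 2).mdiff hq) _).trans ?_
  ring

/-- Mixed derivatives of the coordinates of φ commute, and differentiating the factors e^{±z}
supplies exactly the terms that make the non-symmetric `solGamma` symmetric. -/
theorem β_torsion (m : Fin 3) :
    coordDeriv (basisVec p₀ 0) (h.β p₀ 1 m) + solGamma (h.β p₀ 0) (h.β p₀ 1) m =
      coordDeriv (basisVec p₀ 1) (h.β p₀ 0 m) + solGamma (h.β p₀ 1) (h.β p₀ 0) m := by
  have hc := coordDeriv_comm (basisVec p₀ 0) (basisVec p₀ 1)
  fin_cases m <;>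
    simp [β, solGamma, coordDeriv_expPos, coordDeriv_expNeg, hc] <;> ring

theorem fn_dot_β {q : M} (hq : q ∈ chartDomain p₀) (i j : Fin 2) :
    fn (dot (h.β p₀ i) (h.β p₀ j)) q =
      inducedMetric φ q (ext (basisVec p₀ i) q) (ext (basisVec p₀ j) q) := by
  rw [fn_dot hq, inducedMetric, Sol.metric_eq_dot]
  simp only [fn_β h hq]

variable (p₀)

theorem ext_ne_zero {v : TangentSpace (𝓡 2) p₀} (hv : v ≠ 0) {q : M} (hq : q ∈ chartDomain p₀) :
    ext v q ≠ 0 := fun h => hv ((ext_eq_zero_iff v hq).1 h)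

theorem dot_β₀_pos (q : M) (hq : q ∈ chartDomain p₀) :
    0 < fn (dot (h.β p₀ 0) (h.β p₀ 0)) q := by
  rw [fn_dot_β h hq]
  exact h.inducedMetric_self_pos (ext_ne_zero _
    (by simp : EuclideanSpace.single (0 : Fin 2) (1 : ℝ) ≠ 0) hq)

/-- The inverse length of the first coordinate field. -/
def s₁ : smoothRing p₀ := invSqrt _ (h.dot_β₀_pos p₀)

/-- The expression is the squared length at q of the part of the second coordinate field orthogonal
to the first. -/
theorem gramSchmidt_pos (q : M) (hq : q ∈ chartDomain p₀) :
    0 < fn (dot (h.β p₀ 1) (h.β p₀ 1) - dot (h.β p₀ 0) (h.β p₀ 1) ^ 2 * h.s₁ p₀ ^ 2) q := by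
  have hs := congrArg (ev hq) (invSqrt_sq_mul _ (h.dot_β₀_pos p₀))
  have h0 := h.fn_dot_β hq 0 0
  have h1 := h.fn_dot_β hq 0 1
  have h2 := h.fn_dot_β hq 1 1
  rw [fn_eq_ev hq] at h0 h1 h2
  -- The projection coefficient is frozen at q, so that the orthogonal part is itself the value at q
  -- of an `ext` field with nonzero constant coordinates.
  set c := ev hq (dot (h.β p₀ 0) (h.β p₀ 1)) * ev hq (h.s₁ p₀) ^ 2 with hc
  have hv : basisVec p₀ 1 + (-c) • basisVec p₀ 0 ≠ 0 := single_one_add_smul_ne_zero (-c)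
  have := h.inducedMetric_self_pos (ext_ne_zero p₀ hv hq)
  rw [ext_add _ _ hq, ext_smul _ _ hq] at this
  simp only [inducedMetric_add_left, inducedMetric_add_right, inducedMetric_smul_left,
    inducedMetric_smul_right] at this
  rw [inducedMetric_comm φ q (ext (basisVec p₀ 1) q) (ext (basisVec p₀ 0) q), ← h0, ← h1, ← h2]
    at this
  rw [map_mul, map_pow, map_one] at hs
  rw [fn_eq_ev hq, map_sub, map_mul, map_pow, map_pow]
  change ev hq (h.s₁ p₀) ^ 2 * _ = 1 at hs
  convert this using 1
  rw [hc]
  linear_combination (-ev hq (h.s₁ p₀) ^ 2 * ev hq (dot (h.β p₀ 0) (h.β p₀ 1)) ^ 2) * hs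

/-- The inverse length of the part of the second coordinate field orthogonal to the first. -/
def s₂ : smoothRing p₀ := invSqrt _ (h.gramSchmidt_pos p₀)

/-- The coordinate fields of the preferred chart at `p₀`. -/
def chart : SolChart (smoothRing p₀) where
  d₀ := coordDeriv (basisVec p₀ 0)
  d₁ := coordDeriv (basisVec p₀ 1)
  comm := coordDeriv_comm _ _
  β₀ := h.β p₀ 0
  β₁ := h.β p₀ 1
  n := h.n p₀
  torsion := h.β_torsion
  nn := by
    refine ring_ext fun q hq => ?_
    rw [fn_dot hq, fn_eq_ev hq 1, map_one, ← h.unit q, Sol.metric_eq_dot]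
    simp only [fn_n h hq]
  nβ₀ := by
    refine ring_ext fun q hq => ?_
    rw [fn_dot hq, fn_eq_ev hq 0, map_zero, ← h.normal q (ext (basisVec p₀ 0) q),
      Sol.metric_eq_dot]
    simp only [fn_n h hq, fn_β h hq]
  nβ₁ := by
    refine ring_ext fun q hq => ?_
    rw [fn_dot hq, fn_eq_ev hq 0, map_zero, ← h.normal q (ext (basisVec p₀ 1) q),
      Sol.metric_eq_dot]
    simp only [fn_n h hq, fn_β h hq]
  s₁ := h.s₁ p₀
  s₂ := h.s₂ p₀
  hs₁ := invSqrt_sq_mul _ _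
  hs₂ := invSqrt_sq_mul _ _

end IsSurface
end SolSurface

/-! ### Covariant derivatives and intrinsic curvature in the frame -/

namespace SolFrame
variable {R : Type*} [CommRing R] [Algebra ℝ R] (S : SolFrame R)

theorem dot_nabla₁_combination (w₁ w₂ : R) :
    dot (solNabla S.D₁ S.a fun m => w₁ * S.a m + w₂ * S.b m) S.a = S.D₁ w₁ - S.ω₁ * w₂ ∧
    dot (solNabla S.D₁ S.a fun m => w₁ * S.a m + w₂ * S.b m) S.b = S.D₁ w₂ + S.ω₁ * w₁ := by
  have key : (solNabla S.D₁ S.a fun m => w₁ * S.a m + w₂ * S.b m) = fun m =>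
      (S.D₁ w₁ - S.ω₁ * w₂) * S.a m + (S.D₁ w₂ + S.ω₁ * w₁) * S.b m
        + (S.h₁₁ * w₁ + S.h₁₂ * w₂) * S.n m := by
    funext m
    have ha := S.nabla₁_a m
    have hb := S.nabla₁_b m
    simp only [solNabla, map_add, Derivation.leibniz, smul_eq_mul] at *
    have hΓ : solGamma S.a (fun m => w₁ * S.a m + w₂ * S.b m) m =
        w₁ * solGamma S.a S.a m + w₂ * solGamma S.a S.b m := by
      fin_cases m <;> simp [solGamma] <;> ring
    linear_combination hΓ + w₁ * ha + w₂ * hb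
  have haa := S.aa; have hbb := S.bb; have hab := S.ab; have han := S.an; have hbn := S.bn
  rw [key]
  simp only [dot] at *
  constructor
  · linear_combination (S.D₁ w₁ - S.ω₁ * w₂) * haa + (S.D₁ w₂ + S.ω₁ * w₁) * hab
      + (S.h₁₁ * w₁ + S.h₁₂ * w₂) * han
  · linear_combination (S.D₁ w₁ - S.ω₁ * w₂) * hab + (S.D₁ w₂ + S.ω₁ * w₁) * hbb
      + (S.h₁₁ * w₁ + S.h₁₂ * w₂) * hbn

theorem dot_nabla₂_combination (w₁ w₂ : R) :
    dot (solNabla S.D₂ S.b fun m => w₁ * S.a m + w₂ * S.b m) S.a = S.D₂ w₁ - S.ω₂ * w₂ ∧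
    dot (solNabla S.D₂ S.b fun m => w₁ * S.a m + w₂ * S.b m) S.b = S.D₂ w₂ + S.ω₂ * w₁ := by
  have key : (solNabla S.D₂ S.b fun m => w₁ * S.a m + w₂ * S.b m) = fun m =>
      (S.D₂ w₁ - S.ω₂ * w₂) * S.a m + (S.D₂ w₂ + S.ω₂ * w₁) * S.b m
        + (S.h₁₂ * w₁ + S.h₂₂ * w₂) * S.n m := by
    funext m
    have ha := S.nabla₂_a m
    have hb := S.nabla₂_b m
    simp only [solNabla, map_add, Derivation.leibniz, smul_eq_mul] at *
    have hΓ : solGamma S.b (fun m => w₁ * S.a m + w₂ * S.b m) m =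
        w₁ * solGamma S.b S.a m + w₂ * solGamma S.b S.b m := by
      fin_cases m <;> simp [solGamma] <;> ring
    linear_combination hΓ + w₁ * ha + w₂ * hb
  have haa := S.aa; have hbb := S.bb; have hab := S.ab; have han := S.an; have hbn := S.bn
  rw [key]
  simp only [dot] at *
  constructor
  · linear_combination (S.D₂ w₁ - S.ω₂ * w₂) * haa + (S.D₂ w₂ + S.ω₂ * w₁) * hab
      + (S.h₁₂ * w₁ + S.h₂₂ * w₂) * han
  · linear_combination (S.D₂ w₁ - S.ω₂ * w₂) * hab + (S.D₂ w₂ + S.ω₂ * w₁) * hbb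
      + (S.h₁₂ * w₁ + S.h₂₂ * w₂) * hbn

theorem dot_nabla_n :
    dot (solNabla S.D₁ S.a S.n) S.a = -S.h₁₁ ∧ dot (solNabla S.D₁ S.a S.n) S.b = -S.h₁₂ ∧
    dot (solNabla S.D₂ S.b S.n) S.a = -S.h₁₂ ∧ dot (solNabla S.D₂ S.b S.n) S.b = -S.h₂₂ := by
  refine ⟨?_, ?_, ?_, ?_⟩
  · rw [dot_nabla_swap _ _ S.an, h₁₁]
  · rw [dot_nabla_swap _ _ S.bn, h₁₂]
  · rw [dot_nabla_swap _ _ S.an, S.h₂₁]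
  · rw [dot_nabla_swap _ _ S.bn, h₂₂]

end SolFrame

namespace SolChart
variable {R : Type*} [CommRing R] [Algebra ℝ R] (C : SolChart R)

theorem d₀_eq (u : R) : C.d₀ u = C.t₀₀ * C.frame.D₁ u := by
  have h0 := C.t₀₀_s₁
  simp only [frame, Derivation.smul_apply, smul_eq_mul]
  linear_combination -C.d₀ u * h0

theorem d₁_eq (u : R) : C.d₁ u = C.t₁₀ * C.frame.D₁ u + C.t₁₁ * C.frame.D₂ u := by
  have h1 := C.t₁₁_s₂
  have h2 := C.t₁₀_s₁
  simp only [frame, Derivation.add_apply, Derivation.smul_apply, smul_eq_mul]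
  linear_combination -C.d₁ u * h1 - C.d₀ u * h2

theorem β₀_eq (m : Fin 3) : C.β₀ m = C.t₀₀ * C.frame.a m := by
  have h0 := C.t₀₀_s₁
  simp only [frame]
  linear_combination -C.β₀ m * h0

theorem β₁_eq (m : Fin 3) : C.β₁ m = C.t₁₀ * C.frame.a m + C.t₁₁ * C.frame.b m := by
  have h1 := C.t₁₁_s₂
  have h2 := C.t₁₀_s₁
  simp only [frame]
  linear_combination -C.β₁ m * h1 - C.β₀ m * h2

/-- Vanishing torsion for the coordinate fields, rewritten in the frame. Its a and b components
relate the first derivatives of the triangular coefficients to ω. -/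
theorem torsion_frame (m : Fin 3) :
    (C.t₀₀ * C.frame.D₁ C.t₁₀ - C.t₁₀ * C.frame.D₁ C.t₀₀ - C.t₁₁ * C.frame.D₂ C.t₀₀
        - C.t₀₀ * C.t₁₁ * C.frame.ω₁) * C.frame.a m
      + C.t₀₀ * (C.frame.D₁ C.t₁₁ - C.t₁₁ * C.frame.ω₂) * C.frame.b m = 0 := by
  have ht := C.torsion m
  have hβ₀ : C.β₀ = fun m => C.t₀₀ * C.frame.a m := funext C.β₀_eq
  have hβ₁ : C.β₁ = fun m => C.t₁₀ * C.frame.a m + C.t₁₁ * C.frame.b m := funext C.β₁_eq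
  have h1 := C.frame.nabla₁_a m
  have h2 := C.frame.nabla₁_b m
  have h3 := C.frame.nabla₂_a m
  have hΓ : solGamma C.β₀ C.β₁ m - solGamma C.β₁ C.β₀ m = C.t₀₀ * C.t₁₁ *
      (solGamma C.frame.a C.frame.b m - solGamma C.frame.b C.frame.a m) := by
    rw [hβ₀, hβ₁]
    fin_cases m <;> simp [solGamma] <;> ring
  simp only [d₀_eq, d₁_eq] at ht
  rw [C.β₀_eq m, C.β₁_eq m] at ht
  simp only [solNabla, map_add, Derivation.leibniz, smul_eq_mul] at *
  linear_combination ht - hΓ - C.t₀₀ * C.t₁₁ * (h2 - h3)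

theorem torsion₁ : C.t₀₀ * C.frame.D₁ C.t₁₀ - C.t₁₀ * C.frame.D₁ C.t₀₀
    - C.t₁₁ * C.frame.D₂ C.t₀₀ = C.t₀₀ * C.t₁₁ * C.frame.ω₁ := by
  have h0 := C.torsion_frame 0
  have h1 := C.torsion_frame 1
  have h2 := C.torsion_frame 2
  have haa := C.frame.aa; have hab := C.frame.ab
  simp only [dot] at haa hab
  linear_combination C.frame.a 0 * h0 + C.frame.a 1 * h1 + C.frame.a 2 * h2
    - (C.t₀₀ * C.frame.D₁ C.t₁₀ - C.t₁₀ * C.frame.D₁ C.t₀₀ - C.t₁₁ * C.frame.D₂ C.t₀₀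
        - C.t₀₀ * C.t₁₁ * C.frame.ω₁) * haa
    - C.t₀₀ * (C.frame.D₁ C.t₁₁ - C.t₁₁ * C.frame.ω₂) * hab

theorem torsion₂ : C.t₀₀ * C.frame.D₁ C.t₁₁ = C.t₀₀ * C.t₁₁ * C.frame.ω₂ := by
  have h0 := C.torsion_frame 0
  have h1 := C.torsion_frame 1
  have h2 := C.torsion_frame 2
  have hbb := C.frame.bb; have hab := C.frame.ab
  simp only [dot] at hbb hab
  linear_combination C.frame.b 0 * h0 + C.frame.b 1 * h1 + C.frame.b 2 * h2
    - (C.t₀₀ * C.frame.D₁ C.t₁₀ - C.t₁₀ * C.frame.D₁ C.t₀₀ - C.t₁₁ * C.frame.D₂ C.t₀₀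
        - C.t₀₀ * C.t₁₁ * C.frame.ω₁) * hab
    - C.t₀₀ * (C.frame.D₁ C.t₁₁ - C.t₁₁ * C.frame.ω₂) * hbb

/-- The first component of `∇_Y Z` in the orthonormal frame. -/
def cov₁ (y₁ y₂ z₁ z₂ : R) : R :=
  y₁ * (C.frame.D₁ z₁ - C.frame.ω₁ * z₂) + y₂ * (C.frame.D₂ z₁ - C.frame.ω₂ * z₂)

/-- The second component of `∇_Y Z` in the orthonormal frame. -/
def cov₂ (y₁ y₂ z₁ z₂ : R) : R :=
  y₁ * (C.frame.D₁ z₂ + C.frame.ω₁ * z₁) + y₂ * (C.frame.D₂ z₂ + C.frame.ω₂ * z₁)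

/-- The e₁ component of R(∂₀, ∂₁)∂₁, which suffices because ∂₀ is a multiple of e₁. Through `gauss`
it identifies the extrinsically defined `SolFrame.K` with the curvature of the induced connection.
-/
theorem curvature_eq :
    C.cov₁ C.t₀₀ 0 (C.cov₁ C.t₁₀ C.t₁₁ C.t₁₀ C.t₁₁) (C.cov₂ C.t₁₀ C.t₁₁ C.t₁₀ C.t₁₁)
      - C.cov₁ C.t₁₀ C.t₁₁ (C.cov₁ C.t₀₀ 0 C.t₁₀ C.t₁₁) (C.cov₂ C.t₀₀ 0 C.t₁₀ C.t₁₁) =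
    C.frame.K * C.t₀₀ * C.t₁₁ ^ 2 := by
  -- The second derivatives of t₁₀ occur as d₀ d₁ in one term and d₁ d₀ in the other, so they
  -- cancel.
  have hc := C.comm C.t₁₀
  have h1 := C.torsion₁
  have h2 := C.torsion₂
  have hg := C.frame.gauss
  have hD := C.frame.derivation_comm C.t₁₀
  simp only [d₀_eq, d₁_eq] at hc
  simp only [cov₁, cov₂, map_add, map_sub, Derivation.leibniz, smul_eq_mul, zero_mul, add_zero] at *
  linear_combination hc - C.t₁₁ * C.frame.ω₁ * h1 - C.t₁₁ * C.frame.ω₂ * h2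
    - C.t₀₀ * C.t₁₁ ^ 2 * hg

end SolChart

/-! ### Translation of the geometric operators into the ring -/

namespace SolSurface
variable {M : Type*} [TopologicalSpace M] [ChartedSpace (EuclideanSpace ℝ (Fin 2)) M]

/-- Passing from the coordinate basis to E₁, E₂, E₃ differentiates the factors e^{±z}; this turns
the symmetric coordinate symbols into the constant ones of `solGamma`. -/
theorem comp_ambientCov {φ V : M → Sol} {q : M} (hφ : MDifferentiableAt (𝓡 2) (𝓡 3) φ q)
    (hV : MDifferentiableAt (𝓡 2) (𝓡 3) V q) (X : TangentSpace (𝓡 2) q) (m : Fin 3) :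
    Sol.comp (φ q) (ambientCov φ V q X) m = dfun (fun q => Sol.comp (φ q) (V q) m) q X +
      solGamma (Sol.comp (φ q) (dmap φ q X)) (Sol.comp (φ q) (V q)) m := by
  have hc {W : M → Sol} (hW : MDifferentiableAt (𝓡 2) (𝓡 3) W q) (i : Fin 3) :
      MDifferentiableAt (𝓡 2) 𝓘(ℝ, ℝ) (fun q => W q i) q :=
    (EuclideanSpace.proj i : Sol →L[ℝ] ℝ).mdifferentiable.mdifferentiableAt.comp q hW
  have he : MDifferentiableAt (𝓡 2) 𝓘(ℝ, ℝ) (fun q => Real.exp (φ q 2)) q :=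
    (Real.differentiable_exp.mdifferentiable _).comp q (hc hφ 2)
  have he' : MDifferentiableAt (𝓡 2) 𝓘(ℝ, ℝ) (fun q => Real.exp (-φ q 2)) q :=
    (Real.differentiable_exp.comp differentiable_neg).mdifferentiable.mdifferentiableAt.comp q
      (hc hφ 2)
  have hexp : Real.exp (2 * φ q 2) = Real.exp (φ q 2) * Real.exp (φ q 2) := by
    rw [← Real.exp_add]; ring_nf
  have hexp' : Real.exp (-2 * φ q 2) = Real.exp (-φ q 2) * Real.exp (-φ q 2) := by
    rw [← Real.exp_add]; ring_nf
  fin_cases m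
  · simp only [Sol.comp, ambientCov, Sol.christoffel, solGamma]
    simp
    rw [dfun_fun_mul he (hc hV 0), dfun_comp (Real.hasDerivAt_exp _) (hc hφ 2),
      ← dmap_apply hV, ← dmap_apply hφ]
    ring
  · simp only [Sol.comp, ambientCov, Sol.christoffel, solGamma]
    simp
    rw [dfun_fun_mul he' (hc hV 1), dfun_comp (F := fun t => Real.exp (-t))
      ((hasDerivAt_neg _).exp) (hc hφ 2), ← dmap_apply hV, ← dmap_apply hφ]
    ring
  · simp only [Sol.comp, ambientCov, Sol.christoffel, solGamma, hexp, hexp']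
    simp
    rw [← dmap_apply hV]
    ring

theorem ambientCov_add (φ V : M → Sol) (q : M) (X Y : TangentSpace (𝓡 2) q) :
    ambientCov φ V q (X + Y) = ambientCov φ V q X + ambientCov φ V q Y := by
  ext i
  simp only [ambientCov, dmap_add, Sol.christoffel]
  fin_cases i <;> simp <;> ring

theorem ambientCov_smul (φ V : M → Sol) (q : M) (c : ℝ) (X : TangentSpace (𝓡 2) q) :
    ambientCov φ V q (c • X) = c • ambientCov φ V q X := by
  ext i
  simp only [ambientCov, dmap_smul, Sol.christoffel]
  fin_cases i <;> simp <;> ring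

section
variable {φ : M → Sol} {q : M} {e₁ e₂ : TangentSpace (𝓡 2) q}

theorem Orthonormal₂.inducedMetric_combination (he : Orthonormal₂ φ q e₁ e₂) (x₁ x₂ y₁ y₂ : ℝ) :
    inducedMetric φ q (x₁ • e₁ + x₂ • e₂) (y₁ • e₁ + y₂ • e₂) = x₁ * y₁ + x₂ * y₂ := by
  simp only [inducedMetric_add_left, inducedMetric_add_right, inducedMetric_smul_left,
    inducedMetric_smul_right, inducedMetric_comm φ q e₂ e₁, he.self₁, he.self₂, he.orth]
  ring

theorem Orthonormal₂.isLinearMap_cov (he : Orthonormal₂ φ q e₁ e₂)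
    (W : (p : M) → TangentSpace (𝓡 2) p) : IsLinearMap ℝ (cov φ W q) where
  map_add X Y := by
    simp only [cov, he.tangentPart_eq, ambientCov_add, Sol.metric_add_left]
    module
  map_smul c X := by
    simp only [cov, he.tangentPart_eq, ambientCov_smul, Sol.metric_smul_left]
    module

theorem Orthonormal₂.isLinearMap_shape (he : Orthonormal₂ φ q e₁ e₂) (ξ : M → Sol) :
    IsLinearMap ℝ (shape φ ξ q) where
  map_add X Y := by
    simp only [shape, he.tangentPart_eq, ambientCov_add, Sol.metric_add_left]
    module
  map_smul c X := by
    simp only [shape, he.tangentPart_eq, ambientCov_smul, Sol.metric_smul_left]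
    module

end

namespace IsSurface
variable {φ ξ : M → Sol} {p₀ q : M}

/-- `V` has the components `v` on the chart domain. -/
def HasComp (φ V : M → Sol) (v : Fin 3 → smoothRing p₀) : Prop :=
  ∀ q ∈ chartDomain p₀, ∀ m, Sol.comp (φ q) (V q) m = fn (v m) q

/-- Multiplying the components back by e^{∓z} recovers V. Differentiability has to be known because
`mfderiv` is zero by convention where it fails. -/
theorem mdifferentiableAt_of_hasComp (h : IsSurface φ ξ) {V : M → Sol} {v : Fin 3 → smoothRing p₀}
    (hV : HasComp φ V v) (hq : q ∈ chartDomain p₀) : MDifferentiableAt (𝓡 2) (𝓡 3) V q := by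
  let w : Fin 3 → smoothRing p₀ := ![h.expNeg p₀ * v 0, h.expPos p₀ * v 1, v 2]
  have hw : ContMDiffOn (𝓡 2) 𝓘(ℝ, Fin 3 → ℝ) ∞ (fun q m => fn (w m) q) (chartDomain p₀) :=
    contMDiffOn_pi_space.2 fun m => fn_smooth (w m)
  have hs := (EuclideanSpace.equiv (Fin 3) ℝ).symm.toContinuousLinearMap.contMDiff.comp_contMDiffOn
    hw
  refine (((hs.congr (f₁ := V) ?_).contMDiffAt (chartDomain_mem_nhds hq)).mdifferentiableAt
    (by simp))
  intro q hq
  have hV := hV q hq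
  ext m
  have hexp : Real.exp (-φ q 2) * Real.exp (φ q 2) = 1 := by rw [← Real.exp_add]; simp
  fin_cases m
  · have := hV 0
    simp [Sol.comp, w, fn_eq_ev hq] at this ⊢
    rw [← this]
    simp only [← fn_eq_ev, expNeg, fn_toRing hq]
    linear_combination -V q 0 * hexp
  · have := hV 1
    simp [Sol.comp, w, fn_eq_ev hq] at this ⊢
    rw [← this]
    simp only [← fn_eq_ev, expPos, fn_toRing hq]
    linear_combination -V q 1 * hexp
  · have := hV 2
    simpa [Sol.comp, w] using this

end IsSurface

variable [IsManifold (𝓡 2) ∞ M]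
namespace IsSurface
variable {φ ξ : M → Sol} (h : IsSurface φ ξ) (p₀ : M)

/-- The orthonormal frame on the chart domain, in components. -/
def frame : SolFrame (smoothRing p₀) := (h.chart p₀).frame

/-- The first vector of the frame. -/
def e₁ (q : M) : TangentSpace (𝓡 2) q := fn (h.chart p₀).s₁ q • ext (basisVec p₀ 0) q

/-- The second vector of the frame. -/
def e₂ (q : M) : TangentSpace (𝓡 2) q :=
  fn (h.chart p₀).s₂ q • ext (basisVec p₀ 1) q + fn (h.chart p₀).s₂₀ q • ext (basisVec p₀ 0) q

variable {p₀} {q : M}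

theorem dfun_e₁ (r : smoothRing p₀) (hq : q ∈ chartDomain p₀) :
    dfun (fn r) q (h.e₁ p₀ q) = fn ((h.frame p₀).D₁ r) q := by
  have h0 := fn_coordDeriv (basisVec p₀ 0) r hq
  rw [fn_eq_ev hq] at h0
  rw [e₁, dfun_smul, fn_eq_ev hq, frame, SolChart.frame]
  simp [fn_eq_ev hq, chart, ← h0]

theorem dfun_e₂ (r : smoothRing p₀) (hq : q ∈ chartDomain p₀) :
    dfun (fn r) q (h.e₂ p₀ q) = fn ((h.frame p₀).D₂ r) q := by
  have h0 := fn_coordDeriv (basisVec p₀ 0) r hq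
  have h1 := fn_coordDeriv (basisVec p₀ 1) r hq
  rw [fn_eq_ev hq] at h0 h1
  rw [e₂, dfun_add, dfun_smul, dfun_smul, fn_eq_ev hq, fn_eq_ev hq, frame, SolChart.frame]
  simp [fn_eq_ev hq, chart, ← h0, ← h1]

theorem comp_e₁ (m : Fin 3) (hq : q ∈ chartDomain p₀) :
    Sol.comp (φ q) (dmap φ q (h.e₁ p₀ q)) m = fn ((h.frame p₀).a m) q := by
  have := h.fn_β hq 0 m
  rw [fn_eq_ev hq] at *
  simp only [frame, SolChart.frame, map_mul]
  rw [show (h.chart p₀).β₀ = h.β p₀ 0 from rfl, this]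
  simp only [e₁, dmap_smul, Sol.comp, fn_eq_ev hq]
  fin_cases m <;> simp <;> ring

theorem comp_e₂ (m : Fin 3) (hq : q ∈ chartDomain p₀) :
    Sol.comp (φ q) (dmap φ q (h.e₂ p₀ q)) m = fn ((h.frame p₀).b m) q := by
  have h0 := h.fn_β hq 0 m
  have h1 := h.fn_β hq 1 m
  rw [fn_eq_ev hq] at *
  simp only [frame, SolChart.frame, map_mul, map_add]
  rw [show (h.chart p₀).β₀ = h.β p₀ 0 from rfl, show (h.chart p₀).β₁ = h.β p₀ 1 from rfl, h0, h1]
  simp only [e₂, dmap_add, dmap_smul, Sol.comp, fn_eq_ev hq]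
  fin_cases m <;> simp <;> ring

theorem orthonormal (hq : q ∈ chartDomain p₀) : Orthonormal₂ φ q (h.e₁ p₀ q) (h.e₂ p₀ q) := by
  have key (u v : Fin 3 → smoothRing p₀) (X Y : TangentSpace (𝓡 2) q)
      (hu : ∀ m, Sol.comp (φ q) (dmap φ q X) m = fn (u m) q)
      (hv : ∀ m, Sol.comp (φ q) (dmap φ q Y) m = fn (v m) q) :
      inducedMetric φ q X Y = ev hq (dot u v) := by
    rw [← fn_eq_ev, fn_dot hq, inducedMetric, Sol.metric_eq_dot]
    simp only [← hu, ← hv]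
  constructor
  · rw [key _ _ _ _ (h.comp_e₁ · hq) (h.comp_e₁ · hq), (h.frame p₀).aa, map_one]
  · rw [key _ _ _ _ (h.comp_e₂ · hq) (h.comp_e₂ · hq), (h.frame p₀).bb, map_one]
  · rw [key _ _ _ _ (h.comp_e₁ · hq) (h.comp_e₂ · hq), (h.frame p₀).ab, map_zero]

theorem hasComp_normal : HasComp φ ξ (h.frame p₀).n := fun _ hq m => (h.fn_n hq m).symm

/-- The bridge from geometry to algebra: with V = dφ(W) it yields the induced connection, with V = ξ
the shape operator. -/
theorem tangentPart_ambientCov_e₁ {V : M → Sol} {v : Fin 3 → smoothRing p₀}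
    (hV : HasComp φ V v) (hq : q ∈ chartDomain p₀) :
    tangentPart φ q (ambientCov φ V q (h.e₁ p₀ q)) =
      fn (dot (solNabla (h.frame p₀).D₁ (h.frame p₀).a v) (h.frame p₀).a) q • h.e₁ p₀ q +
      fn (dot (solNabla (h.frame p₀).D₁ (h.frame p₀).a v) (h.frame p₀).b) q • h.e₂ p₀ q := by
  have key (m : Fin 3) : Sol.comp (φ q) (ambientCov φ V q (h.e₁ p₀ q)) m =
      fn (solNabla (h.frame p₀).D₁ (h.frame p₀).a v m) q := by
    rw [comp_ambientCov (h.smooth.mdifferentiableAt (by simp))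
      (h.mdifferentiableAt_of_hasComp hV hq), dfun_congr (fun q hq => hV q hq m) hq, h.dfun_e₁ _ hq]
    have h1 (m) := h.comp_e₁ (p₀ := p₀) m hq
    have h2 := hV q hq
    fin_cases m <;> simp [solNabla, solGamma, fn_eq_ev hq, h1, h2]
  rw [(h.orthonormal hq).tangentPart_eq, Sol.metric_eq_dot, Sol.metric_eq_dot, fn_dot hq, fn_dot hq]
  simp only [← key, ← h.comp_e₁ _ hq, ← h.comp_e₂ _ hq]

theorem tangentPart_ambientCov_e₂ {V : M → Sol} {v : Fin 3 → smoothRing p₀}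
    (hV : HasComp φ V v) (hq : q ∈ chartDomain p₀) :
    tangentPart φ q (ambientCov φ V q (h.e₂ p₀ q)) =
      fn (dot (solNabla (h.frame p₀).D₂ (h.frame p₀).b v) (h.frame p₀).a) q • h.e₁ p₀ q +
      fn (dot (solNabla (h.frame p₀).D₂ (h.frame p₀).b v) (h.frame p₀).b) q • h.e₂ p₀ q := by
  have key (m : Fin 3) : Sol.comp (φ q) (ambientCov φ V q (h.e₂ p₀ q)) m =
      fn (solNabla (h.frame p₀).D₂ (h.frame p₀).b v m) q := by
    rw [comp_ambientCov (h.smooth.mdifferentiableAt (by simp))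
      (h.mdifferentiableAt_of_hasComp hV hq), dfun_congr (fun q hq => hV q hq m) hq, h.dfun_e₂ _ hq]
    have h1 (m) := h.comp_e₂ (p₀ := p₀) m hq
    have h2 := hV q hq
    fin_cases m <;> simp [solNabla, solGamma, fn_eq_ev hq, h1, h2]
  rw [(h.orthonormal hq).tangentPart_eq, Sol.metric_eq_dot, Sol.metric_eq_dot, fn_dot hq, fn_dot hq]
  simp only [← key, ← h.comp_e₁ _ hq, ← h.comp_e₂ _ hq]

/-- `W` has the components `w₁, w₂` in the orthonormal frame on the chart domain. -/
def IsField (W : (p : M) → TangentSpace (𝓡 2) p) (w₁ w₂ : smoothRing p₀) : Prop :=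
  ∀ q ∈ chartDomain p₀, W q = fn w₁ q • h.e₁ p₀ q + fn w₂ q • h.e₂ p₀ q

variable {h}

theorem IsField.hasComp {W : (p : M) → TangentSpace (𝓡 2) p} {w₁ w₂ : smoothRing p₀}
    (hW : h.IsField W w₁ w₂) : HasComp φ (fun q => dmap φ q (W q))
      (fun m => w₁ * (h.frame p₀).a m + w₂ * (h.frame p₀).b m) := by
  intro q hq m
  have h1 := h.comp_e₁ m hq
  have h2 := h.comp_e₂ m hq
  simp only [hW q hq, dmap_add, dmap_smul]
  rw [fn_eq_ev hq (_ + _)]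
  simp only [map_add, map_mul, ← fn_eq_ev, ← h1, ← h2]
  fin_cases m <;> simp [Sol.comp] <;> ring

/-- The result is again a field with components in the ring on the whole chart domain, so covariant
derivatives can be iterated. -/
theorem IsField.cov_e₁ {W : (p : M) → TangentSpace (𝓡 2) p} {w₁ w₂ : smoothRing p₀}
    (hW : h.IsField W w₁ w₂) : h.IsField (fun q => SolSurface.cov φ W q (h.e₁ p₀ q))
      ((h.frame p₀).D₁ w₁ - (h.frame p₀).ω₁ * w₂) ((h.frame p₀).D₁ w₂ + (h.frame p₀).ω₁ * w₁) := by
  intro q hq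
  have := (h.frame p₀).dot_nabla₁_combination w₁ w₂
  beta_reduce
  rw [SolSurface.cov, h.tangentPart_ambientCov_e₁ hW.hasComp hq, this.1, this.2]

theorem IsField.cov_e₂ {W : (p : M) → TangentSpace (𝓡 2) p} {w₁ w₂ : smoothRing p₀}
    (hW : h.IsField W w₁ w₂) : h.IsField (fun q => SolSurface.cov φ W q (h.e₂ p₀ q))
      ((h.frame p₀).D₂ w₁ - (h.frame p₀).ω₂ * w₂) ((h.frame p₀).D₂ w₂ + (h.frame p₀).ω₂ * w₁) := by
  intro q hq
  have := (h.frame p₀).dot_nabla₂_combination w₁ w₂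
  beta_reduce
  rw [SolSurface.cov, h.tangentPart_ambientCov_e₂ hW.hasComp hq, this.1, this.2]

theorem IsField.cov {W Y : (p : M) → TangentSpace (𝓡 2) p} {w₁ w₂ y₁ y₂ : smoothRing p₀}
    (hY : h.IsField Y y₁ y₂) (hW : h.IsField W w₁ w₂) :
    h.IsField (fun q => SolSurface.cov φ W q (Y q)) ((h.chart p₀).cov₁ y₁ y₂ w₁ w₂)
      ((h.chart p₀).cov₂ y₁ y₂ w₁ w₂) := by
  intro q hq
  have hL := (h.orthonormal hq).isLinearMap_cov W
  simp only [hY q hq, hL.map_add, hL.map_smul, hW.cov_e₁ q hq, hW.cov_e₂ q hq, fn_eq_ev hq,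
    SolChart.cov₁, SolChart.cov₂, map_add, map_mul, map_sub, frame]
  module

theorem isField_shape_e₁ : h.IsField (fun q => SolSurface.shape φ ξ q (h.e₁ p₀ q))
    (h.frame p₀).h₁₁ (h.frame p₀).h₁₂ := by
  intro q hq
  have := (h.frame p₀).dot_nabla_n
  beta_reduce
  rw [SolSurface.shape, h.tangentPart_ambientCov_e₁ h.hasComp_normal hq, this.1, this.2.1]
  simp only [fn_eq_ev hq, map_neg]
  module

theorem isField_shape_e₂ : h.IsField (fun q => SolSurface.shape φ ξ q (h.e₂ p₀ q))
    (h.frame p₀).h₁₂ (h.frame p₀).h₂₂ := by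
  intro q hq
  have := (h.frame p₀).dot_nabla_n
  beta_reduce
  rw [SolSurface.shape, h.tangentPart_ambientCov_e₂ h.hasComp_normal hq, this.2.2.1, this.2.2.2]
  simp only [fn_eq_ev hq, map_neg]
  module

theorem IsField.shape {Y : (p : M) → TangentSpace (𝓡 2) p} {y₁ y₂ : smoothRing p₀}
    (hY : h.IsField Y y₁ y₂) : h.IsField (fun q => SolSurface.shape φ ξ q (Y q))
      ((h.frame p₀).h₁₁ * y₁ + (h.frame p₀).h₁₂ * y₂)
      ((h.frame p₀).h₁₂ * y₁ + (h.frame p₀).h₂₂ * y₂) := by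
  intro q hq
  have hL := (h.orthonormal hq).isLinearMap_shape ξ
  simp only [hY q hq, hL.map_add, hL.map_smul, isField_shape_e₁ q hq, isField_shape_e₂ q hq,
    fn_eq_ev hq, map_add, map_mul]
  module

theorem IsField.divergence {W : (p : M) → TangentSpace (𝓡 2) p} {w₁ w₂ : smoothRing p₀}
    (hW : h.IsField W w₁ w₂) (hq : q ∈ chartDomain p₀) : divergence φ W q =
      fn ((h.frame p₀).D₁ w₁ + (h.frame p₀).D₂ w₂ - (h.frame p₀).ω₁ * w₂
        + (h.frame p₀).ω₂ * w₁) q := by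
  have he := h.orthonormal hq
  rw [SolSurface.divergence, he.metricTrace_left (he.isLinearMap_cov W),
    show SolSurface.cov φ W q (h.e₁ p₀ q) = _ from hW.cov_e₁ q hq,
    show SolSurface.cov φ W q (h.e₂ p₀ q) = _ from hW.cov_e₂ q hq]
  simp only [inducedMetric_add_left, inducedMetric_smul_left,
    inducedMetric_comm φ q (h.e₂ p₀ q) (h.e₁ p₀ q), he.self₁, he.self₂, he.orth, fn_eq_ev hq,
    map_add, map_sub, map_mul]
  ring

theorem isField_grad {u : M → ℝ} {r : smoothRing p₀} (hu : ∀ q ∈ chartDomain p₀, u q = fn r q) :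
    h.IsField (fun q => grad φ u q) ((h.frame p₀).D₁ r) ((h.frame p₀).D₂ r) := by
  intro q hq
  beta_reduce
  rw [(h.orthonormal hq).grad_eq, dfun_congr hu hq, dfun_congr hu hq, h.dfun_e₁ _ hq,
    h.dfun_e₂ _ hq]

theorem laplacian_eq {u : M → ℝ} {r : smoothRing p₀} (hu : ∀ q ∈ chartDomain p₀, u q = fn r q)
    (hq : q ∈ chartDomain p₀) : laplacian φ u q =
      fn ((h.frame p₀).D₁ ((h.frame p₀).D₁ r) + (h.frame p₀).D₂ ((h.frame p₀).D₂ r)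
        - (h.frame p₀).ω₁ * (h.frame p₀).D₂ r + (h.frame p₀).ω₂ * (h.frame p₀).D₁ r) q :=
  (isField_grad hu).divergence hq

theorem shapeNormSq_eq (hq : q ∈ chartDomain p₀) : shapeNormSq φ ξ q =
    fn ((h.frame p₀).h₁₁ ^ 2 + 2 * (h.frame p₀).h₁₂ ^ 2 + (h.frame p₀).h₂₂ ^ 2) q := by
  have he := h.orthonormal hq
  rw [shapeNormSq, he.metricTrace_eq (he.isLinearMap_shape ξ) (he.isLinearMap_shape ξ),
    show SolSurface.shape φ ξ q (h.e₁ p₀ q) = _ from isField_shape_e₁ q hq,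
    show SolSurface.shape φ ξ q (h.e₂ p₀ q) = _ from isField_shape_e₂ q hq,
    he.inducedMetric_combination, he.inducedMetric_combination]
  simp only [fn_eq_ev hq, map_add, map_mul, map_pow, map_ofNat]
  ring

theorem meanCurvature_eq (hq : q ∈ chartDomain p₀) : meanCurvature φ ξ q =
    fn ((1 / 2 : ℝ) • ((h.frame p₀).h₁₁ + (h.frame p₀).h₂₂)) q := by
  have he := h.orthonormal hq
  rw [meanCurvature, he.metricTrace_left (he.isLinearMap_shape ξ),
    show SolSurface.shape φ ξ q (h.e₁ p₀ q) = _ from isField_shape_e₁ q hq,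
    show SolSurface.shape φ ξ q (h.e₂ p₀ q) = _ from isField_shape_e₂ q hq]
  simp only [inducedMetric_add_left, inducedMetric_smul_left,
    inducedMetric_comm φ q (h.e₂ p₀ q) (h.e₁ p₀ q), he.self₁, he.self₂, he.orth, fn_eq_ev hq,
    map_add, map_smul, smul_eq_mul]
  ring

end IsSurface
end SolSurface

/-! ### The tensor ∇A, the Gaussian curvature and the angle functions -/

namespace SolSurface
variable {M : Type*} [TopologicalSpace M] [ChartedSpace (EuclideanSpace ℝ (Fin 2)) M]
variable [IsManifold (𝓡 2) ∞ M]
namespace IsSurface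
variable {φ ξ : M → Sol} {h : IsSurface φ ξ} {p₀ q : M}

theorem isField_ext₀ : h.IsField (fun q => ext (basisVec p₀ 0) q) (h.chart p₀).t₀₀ 0 := by
  intro q hq
  have h0 := congrArg (ev hq) (h.chart p₀).t₀₀_s₁
  rw [map_mul, map_one] at h0
  simp only [e₁, fn_eq_ev hq, map_zero]
  rw [smul_smul, h0]
  module

theorem isField_ext₁ :
    h.IsField (fun q => ext (basisVec p₀ 1) q) (h.chart p₀).t₁₀ (h.chart p₀).t₁₁ := by
  intro q hq
  have h1 := congrArg (ev hq) (h.chart p₀).t₁₁_s₂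
  have h2 := congrArg (ev hq) (h.chart p₀).t₁₀_s₁
  rw [map_mul, map_one] at h1
  rw [map_add, map_mul, map_mul, map_zero] at h2
  simp only [e₁, e₂, fn_eq_ev hq]
  symm
  calc
    _ = (ev hq (h.chart p₀).t₁₁ * ev hq (h.chart p₀).s₂) • ext (basisVec p₀ 1) q
        + (ev hq (h.chart p₀).t₁₀ * ev hq (h.chart p₀).s₁
          + ev hq (h.chart p₀).t₁₁ * ev hq (h.chart p₀).s₂₀) • ext (basisVec p₀ 0) q := by module
    _ = _ := by rw [h1, h2]; module

variable (h) in
theorem exists_isField_ext (Y : TangentSpace (𝓡 2) p₀) : ∃ y₁ y₂ : smoothRing p₀,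
    h.IsField (fun q => ext Y q) y₁ y₂ ∧ fn y₁ p₀ = inducedMetric φ p₀ Y (h.e₁ p₀ p₀) ∧
      fn y₂ p₀ = inducedMetric φ p₀ Y (h.e₂ p₀ p₀) := by
  have hp := mem_chart_source (EuclideanSpace ℝ (Fin 2)) p₀
  have hY : h.IsField (fun q => ext Y q)
      (coord Y 0 • (h.chart p₀).t₀₀ + coord Y 1 • (h.chart p₀).t₁₀)
      (coord Y 1 • (h.chart p₀).t₁₁) := by
    intro q hq
    have h0 : ext (basisVec p₀ 0) q = _ := isField_ext₀ (h := h) q hq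
    have h1 : ext (basisVec p₀ 1) q = _ := isField_ext₁ (h := h) q hq
    have : ext Y q = ext (coord Y 0 • basisVec p₀ 0 + coord Y 1 • basisVec p₀ 1) q :=
      congrArg (ext · q) (coord_spec Y)
    beta_reduce
    rw [this, ext_add _ _ hq, ext_smul _ _ hq, ext_smul _ _ hq, h0, h1]
    simp only [fn_eq_ev hq, map_add, map_smul, map_zero, smul_eq_mul]
    module
  have he := h.orthonormal hp
  have hp' : Y = _ := (ext_self Y).symm.trans (hY p₀ hp)
  refine ⟨_, _, hY, ?_, ?_⟩
  · conv_rhs => rw [hp']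
    rw [inducedMetric_add_left, inducedMetric_smul_left, inducedMetric_smul_left,
      inducedMetric_comm φ p₀ (h.e₂ p₀ p₀), he.self₁, he.orth]
    ring
  · conv_rhs => rw [hp']
    rw [inducedMetric_add_left, inducedMetric_smul_left, inducedMetric_smul_left, he.self₂, he.orth]
    ring

variable (h) in
-- The derivatives of the components of the extension of Y cancel between ∇(AY) and A(∇Y), so only
-- the value of Y at the point is left: ∇A is a tensor.
theorem covShape_e₁ (Y : TangentSpace (𝓡 2) p₀) : covShape φ ξ p₀ (h.e₁ p₀ p₀) Y =
    (fn ((h.frame p₀).D₁ (h.frame p₀).h₁₁ - 2 * (h.frame p₀).ω₁ * (h.frame p₀).h₁₂) p₀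
        * inducedMetric φ p₀ Y (h.e₁ p₀ p₀)
      + fn ((h.frame p₀).D₁ (h.frame p₀).h₁₂
          + (h.frame p₀).ω₁ * ((h.frame p₀).h₁₁ - (h.frame p₀).h₂₂)) p₀
        * inducedMetric φ p₀ Y (h.e₂ p₀ p₀)) • h.e₁ p₀ p₀ +
    (fn ((h.frame p₀).D₁ (h.frame p₀).h₁₂
          + (h.frame p₀).ω₁ * ((h.frame p₀).h₁₁ - (h.frame p₀).h₂₂)) p₀
        * inducedMetric φ p₀ Y (h.e₁ p₀ p₀)
      + fn ((h.frame p₀).D₁ (h.frame p₀).h₂₂ + 2 * (h.frame p₀).ω₁ * (h.frame p₀).h₁₂) p₀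
        * inducedMetric φ p₀ Y (h.e₂ p₀ p₀)) • h.e₂ p₀ p₀ := by
  have hp := mem_chart_source (EuclideanSpace ℝ (Fin 2)) p₀
  obtain ⟨y₁, y₂, hY, h1, h2⟩ := h.exists_isField_ext Y
  rw [← h1, ← h2, covShape, show cov φ (fun q => shape φ ξ q (ext Y q)) p₀ (h.e₁ p₀ p₀) = _ from
    hY.shape.cov_e₁ p₀ hp, show shape φ ξ p₀ (cov φ (ext Y) p₀ (h.e₁ p₀ p₀)) = _ from
    hY.cov_e₁.shape p₀ hp]
  simp only [fn_eq_ev hp, map_add, map_sub, map_mul, map_ofNat, Derivation.leibniz, smul_eq_mul]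
  module

variable (h) in
theorem covShape_e₂ (Y : TangentSpace (𝓡 2) p₀) : covShape φ ξ p₀ (h.e₂ p₀ p₀) Y =
    (fn ((h.frame p₀).D₂ (h.frame p₀).h₁₁ - 2 * (h.frame p₀).ω₂ * (h.frame p₀).h₁₂) p₀
        * inducedMetric φ p₀ Y (h.e₁ p₀ p₀)
      + fn ((h.frame p₀).D₂ (h.frame p₀).h₁₂
          + (h.frame p₀).ω₂ * ((h.frame p₀).h₁₁ - (h.frame p₀).h₂₂)) p₀
        * inducedMetric φ p₀ Y (h.e₂ p₀ p₀)) • h.e₁ p₀ p₀ +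
    (fn ((h.frame p₀).D₂ (h.frame p₀).h₁₂
          + (h.frame p₀).ω₂ * ((h.frame p₀).h₁₁ - (h.frame p₀).h₂₂)) p₀
        * inducedMetric φ p₀ Y (h.e₁ p₀ p₀)
      + fn ((h.frame p₀).D₂ (h.frame p₀).h₂₂ + 2 * (h.frame p₀).ω₂ * (h.frame p₀).h₁₂) p₀
        * inducedMetric φ p₀ Y (h.e₂ p₀ p₀)) • h.e₂ p₀ p₀ := by
  have hp := mem_chart_source (EuclideanSpace ℝ (Fin 2)) p₀
  obtain ⟨y₁, y₂, hY, h1, h2⟩ := h.exists_isField_ext Y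
  rw [← h1, ← h2, covShape, show cov φ (fun q => shape φ ξ q (ext Y q)) p₀ (h.e₂ p₀ p₀) = _ from
    hY.shape.cov_e₂ p₀ hp, show shape φ ξ p₀ (cov φ (ext Y) p₀ (h.e₂ p₀ p₀)) = _ from
    hY.cov_e₂.shape p₀ hp]
  simp only [fn_eq_ev hp, map_add, map_sub, map_mul, map_ofNat, Derivation.leibniz, smul_eq_mul]
  module

theorem isLinearMap_covShape_left (h : IsSurface φ ξ) (Y : TangentSpace (𝓡 2) p₀) :
    IsLinearMap ℝ fun X => covShape φ ξ p₀ X Y := by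
  have he := h.orthonormal (mem_chart_source (EuclideanSpace ℝ (Fin 2)) p₀)
  have hs := he.isLinearMap_shape ξ
  have hc (W : (q : M) → TangentSpace (𝓡 2) q) := he.isLinearMap_cov W
  constructor
  · intro X X'
    simp only [covShape, (hc _).map_add, hs.map_add]
    module
  · intro c X
    simp only [covShape, (hc _).map_smul, hs.map_smul]
    module

/-- Linearity in Y, which enters through an extension, is read off from the tensorial formulas after
expanding X in the frame. -/
theorem isLinearMap_covShape_right (h : IsSurface φ ξ) (X : TangentSpace (𝓡 2) p₀) :
    IsLinearMap ℝ fun Y => covShape φ ξ p₀ X Y := by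
  have he := h.orthonormal (mem_chart_source (EuclideanSpace ℝ (Fin 2)) p₀)
  have hX (Y) : covShape φ ξ p₀ X Y = _ :=
    congrArg (covShape φ ξ p₀ · Y) (he.expand X) |>.trans (((h.isLinearMap_covShape_left Y).map_add
      _ _).trans (congrArg₂ (· + ·) ((h.isLinearMap_covShape_left Y).map_smul _ _)
        ((h.isLinearMap_covShape_left Y).map_smul _ _)))
  constructor
  · intro Y Y'
    simp only [hX, h.covShape_e₁, h.covShape_e₂, inducedMetric_add_left]
    module
  · intro c Y
    simp only [hX, h.covShape_e₁, h.covShape_e₂, inducedMetric_smul_left]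
    module

variable (h) in
theorem covShapeNormSq_eq : covShapeNormSq φ ξ p₀ =
    fn (((h.frame p₀).D₁ (h.frame p₀).h₁₁ - 2 * (h.frame p₀).ω₁ * (h.frame p₀).h₁₂) ^ 2
      + 2 * ((h.frame p₀).D₁ (h.frame p₀).h₁₂
          + (h.frame p₀).ω₁ * ((h.frame p₀).h₁₁ - (h.frame p₀).h₂₂)) ^ 2
      + ((h.frame p₀).D₁ (h.frame p₀).h₂₂ + 2 * (h.frame p₀).ω₁ * (h.frame p₀).h₁₂) ^ 2
      + ((h.frame p₀).D₂ (h.frame p₀).h₁₁ - 2 * (h.frame p₀).ω₂ * (h.frame p₀).h₁₂) ^ 2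
      + 2 * ((h.frame p₀).D₂ (h.frame p₀).h₁₂
          + (h.frame p₀).ω₂ * ((h.frame p₀).h₁₁ - (h.frame p₀).h₂₂)) ^ 2
      + ((h.frame p₀).D₂ (h.frame p₀).h₂₂ + 2 * (h.frame p₀).ω₂ * (h.frame p₀).h₁₂) ^ 2) p₀ := by
  have hp := mem_chart_source (EuclideanSpace ℝ (Fin 2)) p₀
  have he := h.orthonormal hp
  have inner (X X' : TangentSpace (𝓡 2) p₀) := he.metricTrace_eq
    (h.isLinearMap_covShape_right X) (h.isLinearMap_covShape_right X')
  simp only [covShapeNormSq, inner, metricTrace_add]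
  have outer (Y : TangentSpace (𝓡 2) p₀) := he.metricTrace_eq
    (h.isLinearMap_covShape_left Y) (h.isLinearMap_covShape_left Y)
  simp only [outer, h.covShape_e₁, h.covShape_e₂, he.inducedMetric_combination, he.self₁, he.self₂,
    he.orth, inducedMetric_comm φ p₀ (h.e₂ p₀ p₀) (h.e₁ p₀ p₀)]
  simp only [fn_eq_ev hp, map_add, map_pow, map_mul, map_ofNat]
  ring

theorem gaussCurvature_eq (h : IsSurface φ ξ) : gaussCurvature φ p₀ = fn (h.frame p₀).K p₀ := by
  have hp := mem_chart_source (EuclideanSpace ℝ (Fin 2)) p₀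
  have he := h.orthonormal hp
  have hX := isField_ext₀ (h := h) (p₀ := p₀)
  have hY := isField_ext₁ (h := h) (p₀ := p₀)
  have h0 : basisVec p₀ 0 = _ := (ext_self _).symm.trans (hX p₀ hp)
  have h1 : basisVec p₀ 1 = _ := (ext_self _).symm.trans (hY p₀ hp)
  have hcurv : curvature φ (ext (basisVec p₀ 0)) (ext (basisVec p₀ 1)) (ext (basisVec p₀ 1)) p₀ =
      _ - _ - _ := congrArg₂ (· - ·) (congrArg₂ (· - ·) (hX.cov (hY.cov hY) p₀ hp)
        (hY.cov (hX.cov hY) p₀ hp)) ((congrArg _ (mlieBracket_ext _ _)).trans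
          (he.isLinearMap_cov _).map_zero)
  have hK := congrArg (ev hp) (h.chart p₀).curvature_eq
  have hs := congrArg (ev hp) (h.chart p₀).t₀₀_s₁
  have ht := congrArg (ev hp) (h.chart p₀).t₁₁_s₂
  rw [map_mul, map_one] at hs ht
  have hs' : ev hp (h.chart p₀).t₀₀ ≠ 0 := left_ne_zero_of_mul_eq_one hs
  have ht' : ev hp (h.chart p₀).t₁₁ ≠ 0 := left_ne_zero_of_mul_eq_one ht
  -- The coordinate basis is triangular over the orthonormal frame with diagonal t₀₀, t₁₁; this
  -- determinant cancels the factor t₀₀² t₁₁² in the numerator.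
  have hdet : (gram φ p₀).det = (ev hp (h.chart p₀).t₀₀ * ev hp (h.chart p₀).t₁₁) ^ 2 := by
    rw [Matrix.det_fin_two]
    simp only [gram, Matrix.of_apply]
    rw [h0, h1]
    simp only [he.inducedMetric_combination, fn_eq_ev hp, map_zero]
    ring
  rw [gaussCurvature, hcurv, hdet]
  have hsub (a b c d : ℝ) (e e' : TangentSpace (𝓡 2) p₀) :
      a • e + b • e' - (c • e + d • e') - 0 = (a - c) • e + (b - d) • e' := by module
  rw [hsub, h0, he.inducedMetric_combination]
  simp only [fn_eq_ev hp, map_zero, mul_zero, add_zero]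
  rw [← map_sub, hK, map_mul, map_mul, map_pow, frame]
  field_simp

theorem tangentField_eq (h : IsSurface φ ξ) {E : Sol → Sol} {v : Fin 3 → ℝ}
    (hE : ∀ x, Sol.comp x (E x) = v) (hq : q ∈ chartDomain p₀) : tangentField φ E q =
      dot v (fun m => fn ((h.frame p₀).a m) q) • h.e₁ p₀ q +
      dot v (fun m => fn ((h.frame p₀).b m) q) • h.e₂ p₀ q := by
  rw [tangentField, (h.orthonormal hq).tangentPart_eq, Sol.metric_eq_dot, Sol.metric_eq_dot, hE]
  simp only [← h.comp_e₁ _ hq, ← h.comp_e₂ _ hq]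

/-- The unit normal is orthogonal to the tangent part of E, so the projection in the definition can
be dropped. -/
theorem angle_eq (h : IsSurface φ ξ) {E : Sol → Sol} {v : Fin 3 → ℝ}
    (hE : ∀ x, Sol.comp x (E x) = v) (hq : q ∈ chartDomain p₀) :
    angle φ ξ E q = dot v (fun m => fn ((h.frame p₀).n m) q) := by
  have hsub : Sol.metric (φ q) (ξ q) (normalPart φ q (E (φ q))) =
      Sol.metric (φ q) (ξ q) (E (φ q)) := by
    have := Sol.metric_add_right (φ q) (ξ q) (normalPart φ q (E (φ q)))
      (dmap φ q (tangentPart φ q (E (φ q))))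
    rw [h.normal, add_zero, normalPart, sub_add_cancel] at this
    rw [normalPart, this]
  rw [angle, hsub, Sol.metric_comm, Sol.metric_eq_dot, hE]
  congr 1
  funext m
  exact h.hasComp_normal q hq m

end IsSurface
end SolSurface

/-! ### Conclusion at the point -/

namespace Sol

theorem comp_E₁ (x : Sol) : comp x (E₁ x) = ![1, 0, 0] := by
  ext m
  fin_cases m <;> simp [comp, E₁, ← Real.exp_add]

theorem comp_E₂ (x : Sol) : comp x (E₂ x) = ![0, 1, 0] := by
  ext m
  fin_cases m <;> simp [comp, E₂, ← Real.exp_add]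

theorem comp_E₃ (x : Sol) : comp x (E₃ x) = ![0, 0, 1] := by
  ext m
  fin_cases m <;> simp [comp, E₃]

end Sol

end

theorem propositionp {M : Type*} [TopologicalSpace M]
    [ChartedSpace (EuclideanSpace ℝ (Fin 2)) M] [IsManifold (𝓡 2) ∞ M]
    (φ ξ : M → Sol)
    (hφ : ContMDiff (𝓡 2) (𝓡 3) ∞ φ)
    (himm : ∀ p : M, Function.Injective (mfderiv (𝓡 2) (𝓡 3) φ p))
    (hξ : ContMDiff (𝓡 2) (𝓡 3) ∞ ξ)
    (hunit : ∀ p : M, Sol.metric (φ p) (ξ p) (ξ p) = 1)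
    (hnormal : ∀ (p : M) (X : TangentSpace (𝓡 2) p),
      Sol.metric (φ p) (ξ p) (SolSurface.dmap φ p X) = 0)
    (p : M) :
    let g := SolSurface.inducedMetric φ p
    let A := SolSurface.shape φ ξ
    let A2 := SolSurface.shapeNormSq φ ξ
    let f := SolSurface.meanCurvature φ ξ
    let gradf := SolSurface.grad φ f
    let K := SolSurface.gaussCurvature φ
    let ν₁ := SolSurface.angle φ ξ Sol.E₁
    let ν₂ := SolSurface.angle φ ξ Sol.E₂
    let ν₃ := SolSurface.angle φ ξ Sol.E₃
    let T₃ := SolSurface.tangentField φ Sol.E₃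
    (1 / 2) * SolSurface.laplacian φ (fun q => A2 q + 2 * ν₃ q ^ 2) p =
      SolSurface.covShapeNormSq φ ξ p - 4 * g (gradf p) (gradf p)
        - 2 * ν₃ p * g (gradf p) (T₃ p)
        + 2 * SolSurface.divergence φ (fun q => A q (gradf q)) p
        - 6 * SolSurface.divergence φ (fun q => (f q * ν₃ q) • T₃ q) p
        + 2 * K p * (A2 p - 2 * f p ^ 2)
        + 2 * ν₃ p ^ 2 * (A2 p + 2 * f p ^ 2 - 3)
        - 2 * g (A p (T₃ p)) (A p (T₃ p))
        - 2 * f p * g (A p (T₃ p)) (T₃ p)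
        + 2 - 2 * (ν₂ p ^ 2 - ν₁ p ^ 2) ^ 2 := by
  intro g A A2 f gradf K ν₁ ν₂ ν₃ T₃
  have h : SolSurface.IsSurface φ ξ := ⟨hφ, himm, hξ, hunit, hnormal⟩
  have hp := mem_chart_source (EuclideanSpace ℝ (Fin 2)) p
  have he := h.orthonormal hp
  set S := h.frame p with hS
  have hν₁ : ν₁ p = SolSurface.fn (S.n 0) p := by
    simp [ν₁, h.angle_eq Sol.comp_E₁ hp, dot, hS]
  have hν₂ : ν₂ p = SolSurface.fn (S.n 1) p := by
    simp [ν₂, h.angle_eq Sol.comp_E₂ hp, dot, hS]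
  have hν₃ (q) (hq : q ∈ SolSurface.chartDomain p) : ν₃ q = SolSurface.fn (S.n 2) q := by
    simp [ν₃, h.angle_eq Sol.comp_E₃ hq, dot, hS]
  have hT : h.IsField T₃ (S.a 2) (S.b 2) := fun q hq => by
    simp [T₃, h.tangentField_eq Sol.comp_E₃ hq, dot, hS]
  have hA2 (q) (hq : q ∈ SolSurface.chartDomain p) :
      A2 q = SolSurface.fn (S.h₁₁ ^ 2 + 2 * S.h₁₂ ^ 2 + S.h₂₂ ^ 2) q := h.shapeNormSq_eq hq
  have hf (q) (hq : q ∈ SolSurface.chartDomain p) :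
      f q = SolSurface.fn ((1 / 2 : ℝ) • (S.h₁₁ + S.h₂₂)) q := h.meanCurvature_eq hq
  have hgrad : h.IsField gradf _ _ := SolSurface.IsSurface.isField_grad hf
  have hfT : h.IsField (fun q => (f q * ν₃ q) • T₃ q)
      ((1 / 2 : ℝ) • (S.h₁₁ + S.h₂₂) * S.n 2 * S.a 2)
      ((1 / 2 : ℝ) • (S.h₁₁ + S.h₂₂) * S.n 2 * S.b 2) := fun q hq => by
    simp only [hf q hq, hν₃ q hq, hT q hq, SolSurface.fn_eq_ev hq, map_mul]
    module
  have hlap := SolSurface.IsSurface.laplacian_eq (h := h) (u := fun q => A2 q + 2 * ν₃ q ^ 2)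
    (r := S.h₁₁ ^ 2 + 2 * S.h₁₂ ^ 2 + S.h₂₂ ^ 2 + 2 * S.n 2 ^ 2)
    (fun q hq => by
      simp only [hA2 q hq, hν₃ q hq, SolSurface.fn_eq_ev hq, map_add, map_mul, map_pow,
        map_ofNat]) hp
  have hK : K p = SolSurface.fn S.K p := h.gaussCurvature_eq
  have hAT : A p (T₃ p) = _ := hT.shape p hp
  have hdiv : SolSurface.divergence φ (fun q => A q (gradf q)) p = _ := hgrad.shape.divergence hp
  -- All auxiliary quantities are fixed by their defining equations through `rfl`, and the ring
  -- identity is evaluated at p.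
  have key := congrArg (SolSurface.ev hp) (S.simons _ _ _ _ _ _ _ _ _ _ _ _ _ rfl rfl rfl rfl rfl
    rfl rfl rfl rfl rfl rfl rfl rfl)
  rw [hlap, hdiv, hfT.divergence hp, hK, hAT, hν₁, hν₂, hν₃ p hp, hgrad p hp, hT p hp, hA2 p hp,
    hf p hp, h.covShapeNormSq_eq]
  simp only [g, he.inducedMetric_combination]
  simp only [SolSurface.fn_eq_ev hp, map_add, map_sub, map_mul, map_pow, map_ofNat, map_smul,
    smul_eq_mul, ← hS, SolFrame.P, smul_mul_assoc, mul_smul_comm, Derivation.map_smul] at key ⊢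
  -- The frame identity computes Δ rather than ½Δ and is written with τ = 2f.
  linear_combination (1 / 2) * key
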